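/- For a finite group $G$ and an integer $n\ge 1$ let $G\wr S_n$ be the complete monomial group: its elements are the tuples $(g_1,\dots,g_n;\pi)$ with $g_i\in G$, $\pi\in S_n$, and the product is $(g_1,\dots,g_n;\pi)(h_1,\dots,h_n;\eta)=(g_1h_{\pi^{-1}(1)},\dots,g_nh_{\pi^{-1}(n)};\pi\eta)$. Let $(G_n)_{n\ge 1}$ be any sequence of non-trivial finite groups and put $\mathcal G_n=G_n\wr S_n$. The warp-transpose top with random shuffle on $\mathcal G_n$ is the random walk with transition probabilities $M(x,y)=P_n(x^{-1}y)$, where $$P_n(x)=\begin{cases}\frac{1}{n|G_n|}, & x=(1,\dots,1,g;\mathrm{id}),\ g\in G_n,\\[2pt] \frac{1}{n|G_n|}, & x=(1,\dots,1,g^{-1},1,\dots,1,g;(i,n)),\ g\in G_n,\ 1\le i<n,\\[2pt] 0,&\text{otherwise,}\end{cases}$$ with $g^{-1}$ in the $i$th and $g$ in the $n$th position in the second line. Let $P_n^{*k}$ be the $k$-fold convolution power of $P_n$ (the law of the walk started at the identity after $k$ steps), $U_{\mathcal G_n}$ the uniform distribution on $\mathcal G_n$, and $\|\mu-\nu\|_{\mathrm{TV}}=\sup_{A}|\mu(A)-\nu(A)|$.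 Then the shuffle exhibits total variation cutoff at time $n\log n$, whatever the orders $|G_n|$ are. That is: for every $n\ge1$, $P_n$ is a probability measure whose support generates $\mathcal G_n$, and the walk is irreducible and aperiodic; $n\log n\to\infty$; and for every $\epsilon\in(0,1)$, $$\lim_{n\to\infty}\left\|P_n^{*\lfloor(1+\epsilon)n\log n\rfloor}-U_{\mathcal G_n}\right\|_{\mathrm{TV}}=0,\qquad \lim_{n\to\infty}\left\|P_n^{*\lfloor(1-\epsilon)n\log n\rfloor}-U_{\mathcal G_n}\right\|_{\mathrm{TV}}=1 .$$ -/

import Mathlib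

open Filter Topology

noncomputable section

/-! ### Random walks on finite groups -/

namespace RandomWalk

/-- A probability measure on a finite set, given by its point masses. -/
def IsProb {Ω : Type*} [Fintype Ω] (p : Ω → ℝ) : Prop :=
  (∀ x, 0 ≤ p x) ∧ ∑ x, p x = 1

/-- The total variation distance `sup_A |μ(A) - ν(A)|`. -/
def tvDist {Ω : Type*} (μ ν : Ω → ℝ) : ℝ :=
  ⨆ A : Finset Ω, |∑ x ∈ A, μ x - ∑ x ∈ A, ν x|

/-- The uniform distribution. -/
def unif (Ω : Type*) [Fintype Ω] : Ω → ℝ :=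
  fun _ => 1 / (Fintype.card Ω : ℝ)

/-- The convolution `(p * q)(x) = ∑_y p(x y⁻¹) q(y)`. -/
def conv {G : Type*} [Group G] [Fintype G] (p q : G → ℝ) : G → ℝ :=
  fun x => ∑ y, p (x * y⁻¹) * q y

open Classical in
/-- The `k`-fold convolution power of `p`; the power `0` is the unit mass at `1`. -/
def convPow {G : Type*} [Group G] [Fintype G] (p : G → ℝ) : ℕ → G → ℝ
  | 0 => fun x => if x = 1 then 1 else 0
  | k + 1 => conv p (convPow p k)

/-- The transition matrix `M(x, y) = p(x⁻¹ y)` of the random walk driven by `p`. -/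
def transition {G : Type*} [Group G] (p : G → ℝ) : Matrix G G ℝ :=
  Matrix.of fun x y => p (x⁻¹ * y)

open Classical in
/-- Every state can be reached from every state with positive probability. -/
def IsIrred {Ω : Type*} [Fintype Ω] (M : Matrix Ω Ω ℝ) : Prop :=
  ∀ x y, ∃ k : ℕ, 0 < (M ^ k) x y

open Classical in
/-- The positive times at which a return to the starting state `x` is possible. -/
def returnTimes {Ω : Type*} [Fintype Ω] (M : Matrix Ω Ω ℝ) (x : Ω) : Set ℕ :=
  {k | 1 ≤ k ∧ 0 < (M ^ k) x x}

/-- Every state has period `1`: the greatest common divisor of its return times is `1`. -/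
def IsAperiodic {Ω : Type*} [Fintype Ω] (M : Matrix Ω Ω ℝ) : Prop :=
  ∀ x, ∀ d : ℕ, (∀ k ∈ returnTimes M x, d ∣ k) → d = 1

/-- Total variation cutoff at time `T n` for a family of random walks on finite groups.
The times `T n` are positive for all large `n`, because they tend to infinity. -/
structure HasTVCutoff {ι : Type*} [Preorder ι] (G : ι → Type*) [∀ n, Group (G n)]
    [∀ n, Fintype (G n)] (p : ∀ n, G n → ℝ) (T : ι → ℝ) : Prop where
  isProb : ∀ n, IsProb (p n)
  generates : ∀ n, Subgroup.closure (Function.support (p n)) = ⊤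
  irreducible : ∀ n, IsIrred (transition (p n))
  aperiodic : ∀ n, IsAperiodic (transition (p n))
  tendsto_time : Tendsto T atTop atTop
  upper : ∀ ε : ℝ, 0 < ε → ε < 1 →
    Tendsto (fun n => tvDist (convPow (p n) ⌊(1 + ε) * T n⌋₊) (unif (G n))) atTop (𝓝 0)
  lower : ∀ ε : ℝ, 0 < ε → ε < 1 →
    Tendsto (fun n => tvDist (convPow (p n) ⌊(1 - ε) * T n⌋₊) (unif (G n))) atTop (𝓝 1)

end RandomWalk

/-! ### The complete monomial group and the shuffle -/

/-- The complete monomial group `G ≀ S_n`: pairs `(g; π)` with the product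
`(g; π) (h; η) = (i ↦ g i * h (π⁻¹ i); π η)`. -/
abbrev Monomial (G : Type*) [Group G] (n : ℕ) : Type _ :=
  (Fin n → G) ⋊[mulAutArrow] Equiv.Perm (Fin n)

namespace Monomial

instance (G : Type*) [Group G] [Fintype G] (n : ℕ) : Fintype (Monomial G n) :=
  Fintype.ofEquiv _ SemidirectProduct.equivProd.symm

/-- The product is the one of the complete monomial group. -/
theorem mul_eq (G : Type*) [Group G] (n : ℕ) (g h : Fin n → G) (π η : Equiv.Perm (Fin n)) :
    (⟨g, π⟩ * ⟨h, η⟩ : Monomial G n) = ⟨fun i => g i * h (π⁻¹ i), π * η⟩ := rfl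

/-- The element `(1, …, 1, g; id)`; the last position is `⊤ : Fin n`. -/
def lastElt {G : Type*} [Group G] {n : ℕ} [NeZero n] (g : G) : Monomial G n :=
  ⟨Pi.mulSingle ⊤ g, 1⟩

/-- For `i ≠ ⊤`, the element `(1, …, 1, g⁻¹, 1, …, 1, g; (i, n))`, with `g⁻¹` in position `i`
and `g` in the last position. -/
def warpElt {G : Type*} [Group G] {n : ℕ} [NeZero n] (i : Fin n) (g : G) : Monomial G n :=
  ⟨Pi.mulSingle i g⁻¹ * Pi.mulSingle ⊤ g, Equiv.swap i ⊤⟩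

open Classical in
/-- The measure driving the warp-transpose top with random shuffle on `G ≀ S_n`. -/
def warpTranspose (G : Type*) [Group G] [Fintype G] (n : ℕ) [NeZero n] : Monomial G n → ℝ :=
  fun x =>
    if (∃ g : G, x = lastElt g) ∨ (∃ i : Fin n, i < ⊤ ∧ ∃ g : G, x = warpElt i g)
    then 1 / ((n : ℝ) * (Fintype.card G : ℝ))
    else 0

end Monomial

end

/-! ### Jucys–Murphy operators in orthogonal representations of symmetric groups -/

namespace StarSum

variable {α V : Type*} [NormedAddCommGroup V] [InnerProductSpace ℝ V]

variable {ρ : Equiv.Perm α →* (V →ₗ[ℝ] V)}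

/-! Condition on the word of places that the shuffle picks. The permutation is then determined, and
from the first time the last place is picked, it and every place picked from then on carry
independent uniform group elements (`placeLaw_congr_of_active`). So the size of the group drops out:
the distance to uniformity is at most the `ℓ¹` distance of the projected walk on `S_n`, a product of
random transpositions `(i n)`, plus the probability that some place is not yet active (`tvDist_le`).
The latter is a coupon collector estimate, at most `(n + 2k) exp(-k/n)` (`avg_active_ne_univ_le`).

For the walk on `S_n`, Cauchy–Schwarz leads to the `ℓ²` distance, which is the sum of `((c +
1)/n)^(2k)` over the eigenvalues `c` of the Jucys–Murphy operator `∑_{i ≠ t} (i t)` in the regular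
representation, minus `1` (`sum_starLaw_sub_sq`). No classification of irreducible representations
is used. An eigenvector with `c > n - 2 - j` is a combination of functions of `j` values of the
inverse permutation (`mem_cylinderSpan_of_eigenvalue`, based on `eq_zero_of_starSum_eq_smul`), so at
most `C(n,j) n^j` eigenvalues are that large; the sign character reflects this to negative
eigenvalues. Summation over `j` gives an exponential series in `n² exp(-2k/n)`, and this quantity
tends to `0` for `k = (1 + ε) n log n`.

For the lower bound, a place other than the last that is never picked is a fixed point. At time `(1
- ε) n log n` the expected number of unpicked places is at least of order `n^ε`, and it is
concentrated by a second moment bound, whereas a uniform permutation has on average at most one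
fixed point (`one_sub_le_tvDist`). -/

theorem rep_mul_apply (σ τ : Equiv.Perm α) (v : V) : ρ (σ * τ) v = ρ σ (ρ τ v) := by
  rw [map_mul]; rfl

theorem norm_rep (hρ : ∀ σ v w, inner ℝ (ρ σ v) (ρ σ w) = inner ℝ v w) (σ : Equiv.Perm α) (v : V) :
    ‖ρ σ v‖ = ‖v‖ := by
  have h := hρ σ v v
  rw [real_inner_self_eq_norm_sq, real_inner_self_eq_norm_sq] at h
  exact (pow_left_inj₀ (norm_nonneg _) (norm_nonneg _) two_ne_zero).1 h

variable [DecidableEq α]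

/-- The operator `∑_{i ∈ B} (i t)` in a representation of the symmetric group. -/
def starSum (ρ : Equiv.Perm α →* (V →ₗ[ℝ] V)) (B : Finset α) (t : α) : V →ₗ[ℝ] V :=
  ∑ i ∈ B, ρ (Equiv.swap i t)

theorem starSum_apply (B : Finset α) (t : α) (v : V) :
    starSum ρ B t v = ∑ i ∈ B, ρ (Equiv.swap i t) v := by
  simp [starSum]

theorem rep_swap_swap (x t : α) (v : V) :
    ρ (Equiv.swap x t) (ρ (Equiv.swap x t) v) = v := by
  rw [← rep_mul_apply, Equiv.swap_mul_self, map_one]; rfl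

theorem starSum_mem {W : Submodule ℝ V} (hW : ∀ σ, ∀ w ∈ W, ρ σ w ∈ W) (B : Finset α) (t : α)
    {w : V} (hw : w ∈ W) : starSum ρ B t w ∈ W := by
  rw [starSum_apply]
  exact W.sum_mem fun i _ => hW _ _ hw

theorem starSum_isSymmetric (hρ : ∀ σ v w, inner ℝ (ρ σ v) (ρ σ w) = inner ℝ v w)
    (B : Finset α) (t : α) : (starSum ρ B t).IsSymmetric := by
  intro v w
  rw [starSum_apply, starSum_apply, sum_inner, inner_sum]
  refine Finset.sum_congr rfl fun i _ => ?_
  rw [← hρ (Equiv.swap i t) v, rep_swap_swap]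

/-- Conjugation by `σ` carries `starSum ρ B t` to the operator of `σ B` and `σ t`. -/
theorem rep_starSum (σ : Equiv.Perm α) (B : Finset α) (t : α) (v : V) :
    ρ σ (starSum ρ B t v) = starSum ρ (B.map σ.toEmbedding) (σ t) (ρ σ v) := by
  rw [starSum_apply, starSum_apply, map_sum, Finset.sum_map]
  refine Finset.sum_congr rfl fun i _ => ?_
  rw [← rep_mul_apply, ← rep_mul_apply, Equiv.coe_toEmbedding, Equiv.swap_apply_apply,
    inv_mul_cancel_right]

theorem map_swap_eq {B : Finset α} {i x : α} (hi : i ∈ B) (hx : x ∈ B) :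
    B.map (Equiv.swap i x).toEmbedding = B := by
  refine Finset.eq_of_subset_of_card_le ?_ (by simp)
  intro y hy
  obtain ⟨z, hz, rfl⟩ := Finset.mem_map.1 hy
  simp only [Equiv.coe_toEmbedding]
  rw [Equiv.swap_apply_def]
  split_ifs <;> assumption

/-- Jucys–Murphy operators commute: every `(i x)` with `i, x ∈ B` preserves `B` and fixes `t`, so
conjugation by it leaves `∑_{i ∈ B} (i t)` unchanged. -/
theorem starSum_comm {B : Finset α} {t x : α} (ht : t ∉ B) (hx : x ∈ B) (v : V) :
    starSum ρ (B.erase x) x (starSum ρ B t v) = starSum ρ B t (starSum ρ (B.erase x) x v) := by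
  rw [starSum_apply (B.erase x), starSum_apply (B.erase x), map_sum]
  refine Finset.sum_congr rfl fun i hi => ?_
  have hiB := Finset.mem_of_mem_erase hi
  rw [rep_starSum, map_swap_eq hiB hx, Equiv.swap_apply_of_ne_of_ne]
  · rintro rfl; exact ht hiB
  · rintro rfl; exact ht hx

/-- The degenerate Hecke relation: conjugation by `(x t)` exchanges `(i t)` and `(i x)`, and the
term `i = x` contributes `(x t)² = 1`. -/
theorem starSum_erase_rep_swap {B : Finset α} {t x : α} (ht : t ∉ B) (hx : x ∈ B) (v : V) :
    starSum ρ (B.erase x) x (ρ (Equiv.swap x t) v) =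
      ρ (Equiv.swap x t) (starSum ρ B t v) - v := by
  have h1 : starSum ρ B t v = ρ (Equiv.swap x t) v + starSum ρ (B.erase x) t v := by
    rw [starSum_apply, starSum_apply, ← Finset.add_sum_erase _ _ hx]
  have h2 : (B.erase x).map (Equiv.swap x t).toEmbedding = B.erase x := by
    refine Finset.eq_of_subset_of_card_le ?_ (Finset.card_map _).ge
    intro y hy
    obtain ⟨z, hz, rfl⟩ := Finset.mem_map.1 hy
    rw [Equiv.coe_toEmbedding, Equiv.swap_apply_of_ne_of_ne]
    · exact hz
    · rintro rfl; simp at hz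
    · rintro rfl; exact ht (Finset.mem_of_mem_erase hz)
  rw [h1, map_add, rep_swap_swap, rep_starSum, h2, Equiv.swap_apply_right]
  abel

theorem norm_starSum_le (hρ : ∀ σ v w, inner ℝ (ρ σ v) (ρ σ w) = inner ℝ v w)
    (B : Finset α) (t : α) (v : V) : ‖starSum ρ B t v‖ ≤ B.card * ‖v‖ := by
  rw [starSum_apply]
  refine (norm_sum_le _ _).trans ?_
  simp [norm_rep hρ]

variable [FiniteDimensional ℝ V]

/-- If a subrepresentation `W` has no nonzero vector that is fixed by a symmetric group on `r + 1`
letters, then every eigenvalue of `∑_{i ∈ B} (i t)` on `W` is at most `r - 1`. -/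
theorem eq_zero_of_starSum_eq_smul (hρ : ∀ σ v w, inner ℝ (ρ σ v) (ρ σ w) = inner ℝ v w)
    {W : Submodule ℝ V} (hW : ∀ σ, ∀ w ∈ W, ρ σ w ∈ W) {r : ℕ}
    (hr : ∀ (C : Finset α) (t : α), t ∉ C → C.card = r →
      ∀ w ∈ W, (∀ x ∈ C, ρ (Equiv.swap x t) w = w) → w = 0) {c : ℝ} (hc : (r : ℝ) - 1 < c)
    (B : Finset α) : ∀ t ∉ B, ∀ w ∈ W, starSum ρ B t w = c • w → w = 0 := by
  induction hn : B.card generalizing B c with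
  | zero =>
    intro t ht w hw h
    rw [Finset.card_eq_zero] at hn
    subst hn
    rcases Nat.eq_zero_or_pos r with rfl | hr0
    · exact hr ∅ t ht rfl w hw (by simp)
    · have hr1 : (1 : ℝ) ≤ r := by exact_mod_cast hr0
      rw [starSum_apply, Finset.sum_empty, eq_comm, smul_eq_zero] at h
      exact h.resolve_left (by linarith)
  | succ m ih =>
    intro t ht w hw h
    -- For `B.card < r` the operator norm is at most `r - 1 < c`, so no eigenvector exists.
    rcases lt_or_ge B.card r with hB | hB
    · have hB' : (B.card : ℝ) + 1 ≤ r := by exact_mod_cast hB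
      have h1 := norm_starSum_le hρ B t w
      have h0 : (0 : ℝ) ≤ B.card := by positivity
      rw [h, norm_smul, Real.norm_eq_abs, abs_of_pos (by linarith)] at h1
      by_contra hw0
      exact absurd (le_of_mul_le_mul_right h1 (norm_pos_iff.2 hw0)) (by linarith)
    -- The part `E` of the `c`-eigenspace in `W` is invariant under the commuting operator of
    -- `B.erase x` and `x`, hence spanned by eigenvectors of that operator. It suffices that `(x t)`
    -- fixes each of these.
    · have key : ∀ x ∈ B, ρ (Equiv.swap x t) w = w := by
        intro x hx
        have hcard : (B.erase x).card = m := by rw [Finset.card_erase_of_mem hx, hn]; rfl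
        let E : Submodule ℝ V := W ⊓ LinearMap.ker (starSum ρ B t - c • LinearMap.id)
        have memE : ∀ v, v ∈ E ↔ v ∈ W ∧ starSum ρ B t v = c • v := by
          intro v
          simp [E, sub_eq_zero]
        have hinv : ∀ v ∈ E, starSum ρ (B.erase x) x v ∈ E := by
          intro v hv
          rw [memE] at hv ⊢
          refine ⟨starSum_mem hW _ _ hv.1, ?_⟩
          rw [← starSum_comm ht hx, hv.2, map_smul]
        have hsym := (starSum_isSymmetric hρ (B.erase x) x).restrict_invariant hinv
        have htop := hsym.orthogonalComplement_iSup_eigenspaces_eq_bot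
        rw [Submodule.orthogonal_eq_bot_iff] at htop
        let K : Submodule ℝ E :=
          (LinearMap.ker (ρ (Equiv.swap x t) - LinearMap.id)).comap E.subtype
        have hK : (⊤ : Submodule ℝ E) ≤ K := by
          rw [← htop]
          refine iSup_le fun a v hv => ?_
          rw [Module.End.mem_eigenspace_iff] at hv
          have hv' : starSum ρ (B.erase x) x (v : V) = a • (v : V) := congrArg Subtype.val hv
          obtain ⟨hvW, hvc⟩ := (memE v).1 v.2
          have goal : ρ (Equiv.swap x t) (v : V) = v := by
            by_cases hv0 : (v : V) = 0
            · simp [hv0]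
            have hac : a < c := by
              by_contra hca
              exact hv0 (ih (by linarith) (B.erase x) hcard x (by simp) v hvW hv')
            have hca : c - a ≠ 0 := by linarith
            -- By the Hecke relation this vector is an eigenvector of the smaller operator with
            -- eigenvalue `c`, so it vanishes by induction. Thus `(x t)` scales `v` by the positive
            -- number `1/(c - a)`, which is `1` because `(x t)` acts isometrically.
            have hz : ρ (Equiv.swap x t) (v : V) - (c - a)⁻¹ • (v : V) = 0 := by
              refine ih hc (B.erase x) hcard x (by simp) _
                (W.sub_mem (hW _ _ hvW) (W.smul_mem _ hvW)) ?_
              rw [map_sub, map_smul, starSum_erase_rep_swap ht hx, hvc, hv', map_smul, smul_sub,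
                sub_sub, smul_smul, smul_smul]
              congr 1
              nth_rewrite 1 [← one_smul ℝ (v : V)]
              rw [← add_smul]
              congr 1
              field_simp
              ring
            rw [sub_eq_zero] at hz
            have hn1 : ‖(v : V)‖ = (c - a)⁻¹ * ‖(v : V)‖ := by
              conv_lhs => rw [← norm_rep hρ (Equiv.swap x t), hz, norm_smul, Real.norm_eq_abs,
                abs_of_pos (inv_pos.2 (by linarith))]
            have h1 : (c - a)⁻¹ = 1 :=
              mul_right_cancel₀ (norm_ne_zero_iff.2 hv0) (by rw [← hn1, one_mul])
            rw [hz, h1, one_smul]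
          simp [K, goal]
        have := hK (Submodule.mem_top (x := (⟨w, (memE w).2 ⟨hw, h⟩⟩ : E)))
        simpa [K, sub_eq_zero] using this
      obtain ⟨C, hCB, hC⟩ := Finset.exists_subset_card_eq hB
      exact hr C t (fun h => ht (hCB h)) hC w hw fun x hx => key x (hCB hx)

end StarSum

/-! ### Large eigenvalues in the regular representation of the symmetric group -/

namespace StarSum

section Eigen

variable {V : Type*} [NormedAddCommGroup V] [InnerProductSpace ℝ V] [FiniteDimensional ℝ V]

/-- An eigenvector of a symmetric operator lies in `U` if its eigenvalue does not occur on `Uᗮ`. -/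
theorem mem_of_eigenvalue_not_on_orthogonal {T : V →ₗ[ℝ] V} (hT : T.IsSymmetric)
    {U : Submodule ℝ V} (hU : ∀ w ∈ Uᗮ, T w ∈ Uᗮ) {c : ℝ} (h : ∀ w ∈ Uᗮ, T w = c • w → w = 0)
    {v : V} (hv : T v = c • v) : v ∈ U := by
  obtain ⟨u, hu, w, hw, rfl⟩ := U.exists_add_mem_mem_orthogonal v
  have hTu : T u ∈ U := by
    rw [← U.orthogonal_orthogonal, Submodule.mem_orthogonal]
    intro x hx
    rw [← hT]
    exact Submodule.inner_left_of_mem_orthogonal hu (hU x hx)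
  have h1 : T w - c • w = -(T u - c • u) := by
    rw [map_add, smul_add] at hv
    rw [eq_neg_iff_add_eq_zero, ← sub_eq_zero.2 hv]
    abel
  have h2 : T w - c • w ∈ U ⊓ Uᗮ :=
    ⟨h1 ▸ U.neg_mem (U.sub_mem hTu (U.smul_mem _ hu)),
      Uᗮ.sub_mem (hU w hw) (Uᗮ.smul_mem _ hw)⟩
  rw [U.inf_orthogonal_eq_bot, Submodule.mem_bot, sub_eq_zero] at h2
  rw [h w hw h2, add_zero]
  exact hu

end Eigen

variable {α : Type*} [Fintype α] [DecidableEq α]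

/-- The left regular representation of the symmetric group on `ℓ²`. -/
noncomputable def regularRep : Equiv.Perm α →* (EuclideanSpace ℝ (Equiv.Perm α) →ₗ[ℝ]
    EuclideanSpace ℝ (Equiv.Perm α)) where
  toFun σ := (LinearIsometryEquiv.piLpCongrLeft 2 ℝ ℝ
    (Equiv.mulLeft σ)).toLinearEquiv.toLinearMap
  map_one' := by
    ext f x
    simp [LinearIsometryEquiv.piLpCongrLeft_apply, Equiv.piCongrLeft'_apply]
    rfl
  map_mul' σ τ := by
    ext f x
    simp [LinearIsometryEquiv.piLpCongrLeft_apply, Equiv.piCongrLeft'_apply]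
    rfl

theorem regularRep_apply (σ : Equiv.Perm α) (f : EuclideanSpace ℝ (Equiv.Perm α))
    (x : Equiv.Perm α) : regularRep σ f x = f (σ⁻¹ * x) := by
  simp [regularRep, LinearIsometryEquiv.piLpCongrLeft_apply, Equiv.piCongrLeft'_apply]

theorem inner_regularRep (σ : Equiv.Perm α) (v w : EuclideanSpace ℝ (Equiv.Perm α)) :
    inner ℝ (regularRep σ v) (regularRep σ w) = inner ℝ v w :=
  (LinearIsometryEquiv.piLpCongrLeft 2 ℝ ℝ (Equiv.mulLeft σ)).inner_map_map v w

/-- The indicator function of the permutations `y` whose inverse is prescribed on `D`. -/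
noncomputable def cylinder (D : Finset α) (φ : D → α) : EuclideanSpace ℝ (Equiv.Perm α) :=
  WithLp.toLp 2 fun y => if ∀ d : D, y⁻¹ d = φ d then 1 else 0

variable (α) in
/-- The span of the functions of a permutation that depend on `j` values of its inverse. -/
def cylinderSpan (j : ℕ) : Submodule ℝ (EuclideanSpace ℝ (Equiv.Perm α)) :=
  Submodule.span ℝ (Set.range fun p : Σ D : {D : Finset α // D.card = j}, (D.1 → α) =>
    cylinder p.1.1 p.2)

theorem finrank_cylinderSpan_le (j : ℕ) :
    Module.finrank ℝ (cylinderSpan α j) ≤ (Fintype.card α).choose j * Fintype.card α ^ j := by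
  refine (finrank_range_le_card _).trans (le_of_eq ?_)
  rw [Fintype.card_sigma]
  rw [Finset.sum_congr rfl (g := fun _ => Fintype.card α ^ j)]
  · simp
  · rintro ⟨D, rfl⟩ -
    simp

theorem mem_orthogonal_cylinderSpan {j : ℕ} {f : EuclideanSpace ℝ (Equiv.Perm α)} :
    f ∈ (cylinderSpan α j)ᗮ ↔ ∀ D : Finset α, D.card = j → ∀ φ : α → α,
      ∑ y, (if ∀ d ∈ D, y⁻¹ d = φ d then f y else 0) = 0 := by
  have hin : ∀ (D : Finset α) (φ : D → α), inner ℝ (cylinder D φ) f =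
      ∑ y, (if ∀ d : D, y⁻¹ d = φ d then f y else 0) := by
    intro D φ
    simp [cylinder, PiLp.inner_apply]
  constructor
  · intro h D hD φ
    have := (Submodule.mem_orthogonal _ _).1 h _
      (Submodule.subset_span ⟨⟨⟨D, hD⟩, fun d => φ d⟩, rfl⟩)
    rw [hin] at this
    simpa using this
  · intro h
    rw [cylinderSpan, Submodule.mem_orthogonal]
    intro u hu
    induction hu using Submodule.span_induction with
    | mem u hu =>
      obtain ⟨⟨⟨D, hD⟩, φ⟩, rfl⟩ := hu
      simp only
      rw [hin]
      refine Eq.trans ?_ (h D hD fun d => if hd : d ∈ D then φ ⟨d, hd⟩ else d)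
      refine Finset.sum_congr rfl fun y _ => ?_
      congr 1
      refine propext ⟨fun H d hd => ?_, fun H d => ?_⟩
      · simpa [hd] using H ⟨d, hd⟩
      · simpa using H d d.2
    | zero => simp
    | add u v _ _ hu hv => rw [inner_add_left, hu, hv, add_zero]
    | smul a u _ hu => rw [inner_smul_left, hu, mul_zero]

theorem regularRep_mem_orthogonal_cylinderSpan {j : ℕ} (τ : Equiv.Perm α) :
    ∀ f ∈ (cylinderSpan α j)ᗮ, regularRep τ f ∈ (cylinderSpan α j)ᗮ := by
  intro f hf
  rw [mem_orthogonal_cylinderSpan] at hf ⊢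
  intro D hD φ
  refine Eq.trans ?_ (hf (D.map (τ⁻¹).toEmbedding) (by simpa using hD) (fun d => φ (τ d)))
  rw [← Equiv.sum_comp (Equiv.mulLeft τ)]
  refine Finset.sum_congr rfl fun y _ => ?_
  have hτ : ∀ d, τ (τ⁻¹ d) = d := τ.apply_symm_apply
  simp only [regularRep_apply, Equiv.coe_mulLeft, inv_mul_cancel_left, Finset.forall_mem_map,
    Equiv.coe_toEmbedding, mul_inv_rev, Equiv.Perm.mul_apply, hτ]

/-- A permutation that fixes every point outside `insert t C` is a product of
transpositions `(x t)` with `x ∈ C`. -/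
theorem mem_closure_star_swaps {C : Finset α} {t : α} (ht : t ∉ C) {σ : Equiv.Perm α}
    (hσ : ∀ d ∉ insert t C, σ d = d) :
    σ ∈ Subgroup.closure {τ | ∃ x ∈ C, τ = Equiv.swap x t} := by
  set S : Set (Equiv.Perm α) := {τ | ∃ x ∈ C, τ = Equiv.swap x t}
  have hS : ∀ τ ∈ S, τ.IsSwap := by
    rintro _ ⟨x, hx, rfl⟩
    exact ⟨x, t, fun h => ht (h ▸ hx), rfl⟩
  rw [mem_closure_isSwap hS]
  refine ⟨Set.toFinite _, fun x => ?_⟩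
  have horb : ∀ y ∈ insert t C, y ∈ MulAction.orbit (Subgroup.closure S) t := by
    intro y hy
    rcases Finset.mem_insert.1 hy with rfl | hy
    · exact MulAction.mem_orbit_self _
    · exact ⟨⟨Equiv.swap y t, Subgroup.subset_closure ⟨y, hy, rfl⟩⟩, Equiv.swap_apply_right y t⟩
  by_cases hx : x ∈ insert t C
  · have hsx : σ x ∈ insert t C := by
      by_contra h
      exact h (by rwa [σ.injective (hσ _ h)])
    rw [MulAction.orbit_eq_iff.2 (horb x hx)]
    exact horb _ hsx
  · rw [hσ x hx]
    exact MulAction.mem_orbit_self x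

/-- Let `D` be the complement of `insert t C`, which has `j` elements. A function fixed by these
transpositions is constant on each set of permutations `y` with `y⁻¹` prescribed on `D`.
Orthogonality to the indicator of that set makes the constant zero. -/
theorem eq_zero_of_fixed_of_mem_orthogonal {r j : ℕ} (hrj : r + 1 + j = Fintype.card α)
    (C : Finset α) (t : α) (ht : t ∉ C) (hC : C.card = r) :
    ∀ w ∈ (cylinderSpan α j)ᗮ, (∀ x ∈ C, regularRep (Equiv.swap x t) w = w) → w = 0 := by
  intro w hw hfix
  have hstab : ∀ σ ∈ Subgroup.closure {τ : Equiv.Perm α | ∃ x ∈ C, τ = Equiv.swap x t},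
      regularRep σ w = w := by
    intro σ hσ
    induction hσ using Subgroup.closure_induction with
    | mem σ h => obtain ⟨x, hx, rfl⟩ := h; exact hfix x hx
    | one => simp
    | mul σ τ _ _ hσ hτ => rw [rep_mul_apply, hτ, hσ]
    | inv σ _ hσ =>
      conv_lhs => rw [← hσ]
      rw [← rep_mul_apply]; simp
  ext x
  have hD : (insert t C)ᶜ.card = j := by
    rw [Finset.card_compl, Finset.card_insert_of_notMem ht]; lia
  have h := mem_orthogonal_cylinderSpan.1 hw _ hD (fun d => x⁻¹ d)
  have hval : ∀ y : Equiv.Perm α, (if ∀ d ∈ (insert t C)ᶜ, y⁻¹ d = x⁻¹ d then w y else 0) =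
      (if ∀ d ∈ (insert t C)ᶜ, y⁻¹ d = x⁻¹ d then 1 else 0) * w x := by
    intro y
    split_ifs with hy
    · have hm : x * y⁻¹ ∈ Subgroup.closure {τ : Equiv.Perm α | ∃ x ∈ C, τ = Equiv.swap x t} := by
        refine mem_closure_star_swaps ht fun d hd => ?_
        rw [Equiv.Perm.mul_apply, hy d (by simpa using hd)]
        simp
      have := congrArg (fun v => v x) (hstab _ hm)
      simp only [regularRep_apply] at this
      rw [one_mul, ← this]
      group
    · simp
  rw [Finset.sum_congr rfl fun y _ => hval y, ← Finset.sum_mul] at h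
  refine (mul_eq_zero.1 h).resolve_left (ne_of_gt ?_)
  refine Finset.sum_pos' (fun y _ => by split_ifs <;> norm_num) ⟨x, Finset.mem_univ _, by simp⟩

/-- An eigenfunction of `∑_{i ≠ t} (i t)` with a large eigenvalue is a combination of functions
that depend on few values. -/
theorem mem_cylinderSpan_of_eigenvalue {j : ℕ} (hj : j < Fintype.card α) (t : α) {c : ℝ}
    (hc : (Fintype.card α : ℝ) - 2 - j < c) {v : EuclideanSpace ℝ (Equiv.Perm α)}
    (hv : starSum regularRep (Finset.univ.erase t) t v = c • v) : v ∈ cylinderSpan α j := by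
  -- With `r = n - 1 - j`, the threshold `r - 1` becomes `n - 2 - j`.
  obtain ⟨r, hr⟩ : ∃ r, r + 1 + j = Fintype.card α := ⟨Fintype.card α - 1 - j, by lia⟩
  refine mem_of_eigenvalue_not_on_orthogonal (starSum_isSymmetric inner_regularRep _ t)
    (fun w hw => starSum_mem regularRep_mem_orthogonal_cylinderSpan _ _ hw) ?_ hv
  refine eq_zero_of_starSum_eq_smul inner_regularRep regularRep_mem_orthogonal_cylinderSpan
    (eq_zero_of_fixed_of_mem_orthogonal hr) ?_ _ t (by simp)
  rw [← hr] at hc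
  push_cast at hc
  linarith

theorem card_eigenvalue_gt_le {j : ℕ} (hj : j < Fintype.card α) (t : α) {ι : Type*} [Fintype ι]
    {v : ι → EuclideanSpace ℝ (Equiv.Perm α)} (hli : LinearIndependent ℝ v) {c : ι → ℝ}
    (hv : ∀ i, starSum regularRep (Finset.univ.erase t) t (v i) = c i • v i) :
    (Finset.univ.filter fun i => (Fintype.card α : ℝ) - 2 - j < c i).card ≤
      (Fintype.card α).choose j * Fintype.card α ^ j := by
  refine le_trans ?_ (finrank_cylinderSpan_le j)
  have h1 := hli.comp (Subtype.val : {i // (Fintype.card α : ℝ) - 2 - j < c i} → ι)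
    Subtype.val_injective
  rw [← Fintype.card_subtype, ← finrank_span_eq_card h1]
  refine Submodule.finrank_mono (Submodule.span_le.2 ?_)
  rintro _ ⟨i, rfl⟩
  exact mem_cylinderSpan_of_eigenvalue hj t i.2 (hv i)

/-- Multiplication by the sign character. -/
noncomputable def signTwist : EuclideanSpace ℝ (Equiv.Perm α) →ₗ[ℝ]
    EuclideanSpace ℝ (Equiv.Perm α) where
  toFun f := WithLp.toLp 2 fun x => ((Equiv.Perm.sign x : ℤ) : ℝ) * f x
  map_add' f g := by ext x; simp [mul_add]
  map_smul' a f := by ext x; simp [mul_left_comm]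

theorem signTwist_apply (f : EuclideanSpace ℝ (Equiv.Perm α)) (x : Equiv.Perm α) :
    signTwist f x = ((Equiv.Perm.sign x : ℤ) : ℝ) * f x := rfl

theorem signTwist_injective : Function.Injective (signTwist (α := α)) := by
  intro f g h
  ext x
  have := congrArg (fun v => v x) h
  simp only [signTwist_apply] at this
  rcases Int.units_eq_one_or (Equiv.Perm.sign x) with hx | hx <;> simpa [hx] using this

/-- Transpositions are odd, so the twist carries eigenvalue `c` to `-c`; this turns counts of large
eigenvalues into counts of very negative ones. -/
theorem starSum_signTwist (t : α) (v : EuclideanSpace ℝ (Equiv.Perm α)) :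
    starSum regularRep (Finset.univ.erase t) t (signTwist v) =
      -signTwist (starSum regularRep (Finset.univ.erase t) t v) := by
  rw [starSum_apply, starSum_apply, map_sum, ← Finset.sum_neg_distrib]
  refine Finset.sum_congr rfl fun i hi => ?_
  ext x
  have hit : i ≠ t := Finset.ne_of_mem_erase hi
  simp [regularRep_apply, signTwist_apply, Equiv.Perm.sign_swap hit]

end StarSum

/-! ### The `ℓ²` bound for the star transposition walk -/

namespace StarSum

variable {α : Type*} [Fintype α] [DecidableEq α]

/-- The law of the product of `k` independent transpositions `(i t)` with `i` uniform. -/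
noncomputable def starLaw (t : α) : ℕ → Equiv.Perm α → ℝ
  | 0 => fun x => if x = 1 then 1 else 0
  | k + 1 => fun x => (Fintype.card α : ℝ)⁻¹ * ∑ i, starLaw t k (Equiv.swap i t * x)

theorem sum_starLaw (t : α) (k : ℕ) : ∑ x, starLaw t k x = 1 := by
  induction k with
  | zero => simp [starLaw]
  | succ k ih =>
    have hn : (Fintype.card α : ℝ) ≠ 0 := by
      have := Fintype.card_pos_iff.2 ⟨t⟩
      positivity
    simp only [starLaw]
    rw [← Finset.mul_sum, Finset.sum_comm]
    have : ∀ i, ∑ x, starLaw t k (Equiv.swap i t * x) = 1 := fun i => by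
      rw [← ih]
      exact Equiv.sum_comp (Equiv.mulLeft (Equiv.swap i t)) (starLaw t k)
    simp [this, hn]

/-- The term `i = t` is the identity, which is why the walk has eigenvalues `(c + 1)/n`. -/
theorem starSum_univ (t : α) (v : EuclideanSpace ℝ (Equiv.Perm α)) :
    starSum regularRep Finset.univ t v =
      starSum regularRep (Finset.univ.erase t) t v + v := by
  rw [starSum_apply, starSum_apply, ← Finset.sum_erase_add _ _ (Finset.mem_univ t),
    Equiv.swap_self]
  congr 1

theorem starSum_univ_apply (t : α) (v : EuclideanSpace ℝ (Equiv.Perm α)) (x : Equiv.Perm α) :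
    starSum regularRep Finset.univ t v x = ∑ i, v (Equiv.swap i t * x) := by
  rw [starSum_apply]
  simp [regularRep_apply]

theorem starSum_univ_pow_apply (t : α) (k : ℕ) (x : Equiv.Perm α) :
    (starSum regularRep Finset.univ t ^ k) (EuclideanSpace.single 1 1) x =
      (Fintype.card α : ℝ) ^ k * starLaw t k x := by
  have hn : (Fintype.card α : ℝ) ≠ 0 := by
    have := Fintype.card_pos_iff.2 ⟨t⟩
    positivity
  induction k generalizing x with
  | zero => simp [starLaw]
  | succ k ih =>
    rw [pow_succ', Module.End.mul_apply, starSum_univ_apply]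
    simp only [ih, starLaw]
    rw [← Finset.mul_sum, pow_succ]
    field_simp

theorem starSum_univ_pow_single (t : α) (k : ℕ) (x y : Equiv.Perm α) :
    (starSum regularRep Finset.univ t ^ k) (EuclideanSpace.single x 1) y =
      (starSum regularRep Finset.univ t ^ k) (EuclideanSpace.single 1 1) (y * x⁻¹) := by
  induction k generalizing y with
  | zero => simp [mul_inv_eq_one]
  | succ k ih =>
    rw [pow_succ', Module.End.mul_apply, Module.End.mul_apply, starSum_univ_apply,
      starSum_univ_apply]
    simp [ih, mul_assoc]

/-- The operator commutes with right translations, so all `n!` diagonal entries of its power are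
equal. By symmetry each is the squared norm of the `k`th power applied to the unit mass at `1`. -/
theorem trace_starSum_univ_pow (t : α) (k : ℕ) :
    LinearMap.trace ℝ _ (starSum regularRep (Finset.univ : Finset α) t ^ (2 * k)) =
      (Fintype.card α).factorial * ((Fintype.card α : ℝ) ^ (2 * k) * ∑ x, starLaw t k x ^ 2) := by
  rw [LinearMap.trace_eq_sum_inner _ (EuclideanSpace.basisFun (Equiv.Perm α) ℝ)]
  have h : ∀ x : Equiv.Perm α, inner ℝ (EuclideanSpace.basisFun (Equiv.Perm α) ℝ x)
      ((starSum regularRep (Finset.univ : Finset α) t ^ (2 * k))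
        (EuclideanSpace.basisFun (Equiv.Perm α) ℝ x)) =
      (Fintype.card α : ℝ) ^ (2 * k) * ∑ x, starLaw t k x ^ 2 := by
    intro x
    have hsym : (starSum (regularRep (α := α)) Finset.univ t ^ k).IsSymmetric :=
      (starSum_isSymmetric inner_regularRep _ t).pow k
    rw [EuclideanSpace.basisFun_apply, EuclideanSpace.inner_single_left, starSum_univ_pow_single,
      mul_inv_cancel, ← EuclideanSpace.inner_single_left, two_mul, pow_add, Module.End.mul_apply,
      ← hsym, PiLp.inner_apply]
    simp only [starSum_univ_pow_apply]
    rw [Finset.mul_sum]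
    refine Finset.sum_congr rfl fun y _ => ?_
    simp only [real_inner_self_eq_norm_sq, Real.norm_eq_abs, sq_abs]
    ring
  rw [Finset.sum_congr rfl fun x _ => h x]
  simp [Fintype.card_perm]

/-- The `ℓ²` distance to the uniform distribution in terms of the eigenvalues of the walk. -/
theorem sum_starLaw_sub_sq (t : α) (k : ℕ) {N : ℕ}
    {b : OrthonormalBasis (Fin N) ℝ (EuclideanSpace ℝ (Equiv.Perm α))} {c : Fin N → ℝ}
    (hb : ∀ i, starSum regularRep (Finset.univ.erase t) t (b i) = c i • b i) :
    (Fintype.card α).factorial *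
        ∑ x, (starLaw t k x - 1 / ((Fintype.card α).factorial : ℝ)) ^ 2 =
      ∑ i, ((c i + 1) / Fintype.card α) ^ (2 * k) - 1 := by
  have hn : (Fintype.card α : ℝ) ≠ 0 := by
    have := Fintype.card_pos_iff.2 ⟨t⟩
    positivity
  have hf : ((Fintype.card α).factorial : ℝ) ≠ 0 := by positivity
  have hev : ∀ i m, (starSum regularRep Finset.univ t ^ m) (b i) = (c i + 1) ^ m • b i := by
    intro i m
    induction m with
    | zero => simp
    | succ m ih =>
      rw [pow_succ', Module.End.mul_apply, ih, map_smul, starSum_univ, hb, pow_succ, mul_smul,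
        add_smul, one_smul]
  have htr := trace_starSum_univ_pow t k
  rw [LinearMap.trace_eq_sum_inner _ b] at htr
  have h1 : ∀ i, inner ℝ (b i) ((starSum regularRep Finset.univ t ^ (2 * k)) (b i)) =
      (c i + 1) ^ (2 * k) := by
    intro i
    rw [hev, inner_smul_right, real_inner_self_eq_norm_sq, b.norm_eq_one]
    simp
  rw [Finset.sum_congr rfl fun i _ => h1 i] at htr
  have h2 : ∑ i, ((c i + 1) / Fintype.card α) ^ (2 * k) =
      (Fintype.card α).factorial * ∑ x, starLaw t k x ^ 2 := by
    simp only [div_pow]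
    rw [← Finset.sum_div, htr]
    field_simp
  have h3 : ∑ x, (starLaw t k x - 1 / ((Fintype.card α).factorial : ℝ)) ^ 2 =
      ∑ x, starLaw t k x ^ 2 - 1 / ((Fintype.card α).factorial : ℝ) := by
    simp only [sub_sq]
    rw [Finset.sum_add_distrib, Finset.sum_sub_distrib, ← Finset.sum_mul, ← Finset.mul_sum,
      sum_starLaw]
    simp only [Finset.sum_const, Finset.card_univ, Fintype.card_perm, nsmul_eq_mul]
    field_simp
    ring
  rw [h2, h3]
  field_simp

theorem norm_eigenvalue_le (t : α) {c : ℝ} {v : EuclideanSpace ℝ (Equiv.Perm α)} (hv0 : v ≠ 0)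
    (hv : starSum regularRep (Finset.univ.erase t) t v = c • v) :
    |c| ≤ (Fintype.card α : ℝ) - 1 := by
  have h := norm_starSum_le inner_regularRep (Finset.univ.erase t) t v
  rw [hv, norm_smul, Real.norm_eq_abs, Finset.card_erase_of_mem (Finset.mem_univ t),
    Finset.card_univ, Nat.cast_pred (Fintype.card_pos_iff.2 ⟨t⟩)] at h
  exact le_of_mul_le_mul_right h (norm_pos_iff.2 hv0)

/-- Sorts eigenvalues into layers, so that only counts above thresholds are needed: `c > -1` lies in
layer `j = ⌊n - 1 - c⌋`, and `c < -1` in layer `j = ⌊n - 1 + c⌋`. For negative `c` the holding term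
`+1` works against `|c|`, whence `j + 2` in place of `j`. -/
theorem pow_eigenvalue_le_sum {n k : ℕ} (hn : 0 < n) (hk : 0 < k) {c : ℝ} (hc : |c| ≤ n - 1) :
    ((c + 1) / n) ^ (2 * k) ≤
      ∑ j ∈ Finset.range n, (if (n : ℝ) - 2 - j < c then (1 - j / (n : ℝ)) ^ (2 * k) else 0) +
      ∑ j ∈ Finset.range (n - 1),
        (if (n : ℝ) - 2 - j < -c then (1 - (j + 2) / (n : ℝ)) ^ (2 * k) else 0) := by
  have hn' : (0 : ℝ) < n := by exact_mod_cast hn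
  obtain ⟨hc1, hc2⟩ := abs_le.1 hc
  have p1 : ∀ j ∈ Finset.range n,
      0 ≤ (if (n : ℝ) - 2 - j < c then (1 - j / (n : ℝ)) ^ (2 * k) else 0) := by
    intro j _
    split_ifs
    · exact Even.pow_nonneg (even_two_mul k) _
    · exact le_rfl
  have p2 : ∀ j ∈ Finset.range (n - 1),
      0 ≤ (if (n : ℝ) - 2 - j < -c then (1 - (j + 2) / (n : ℝ)) ^ (2 * k) else 0) := by
    intro j _
    split_ifs
    · exact Even.pow_nonneg (even_two_mul k) _
    · exact le_rfl
  rcases le_or_gt (-1) c with h | h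
  -- At `c = -1` the left side is `0 ^ (2 * k)`, which vanishes because `k > 0`.
  · rcases h.eq_or_lt with rfl | h
    · rw [neg_add_cancel, zero_div, zero_pow (by positivity)]
      exact add_nonneg (Finset.sum_nonneg p1) (Finset.sum_nonneg p2)
    refine le_add_of_le_of_nonneg ?_ (Finset.sum_nonneg p2)
    have hf1 := Nat.floor_le (a := (n : ℝ) - 1 - c) (by linarith)
    have hf2 := Nat.lt_floor_add_one ((n : ℝ) - 1 - c)
    set j := ⌊(n : ℝ) - 1 - c⌋₊
    have hj : j ∈ Finset.range n := by
      rw [Finset.mem_range]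
      have : (j : ℝ) < n := by linarith
      exact_mod_cast this
    refine le_trans ?_ (Finset.single_le_sum p1 hj)
    rw [if_pos (by linarith)]
    refine pow_le_pow_left₀ (div_nonneg (by linarith) hn'.le) ?_ _
    rw [div_le_iff₀ hn', sub_mul, div_mul_cancel₀ _ hn'.ne']
    linarith
  · refine le_add_of_nonneg_of_le (Finset.sum_nonneg p1) ?_
    have hf1 := Nat.floor_le (a := (n : ℝ) - 1 + c) (by linarith)
    have hf2 := Nat.lt_floor_add_one ((n : ℝ) - 1 + c)
    set j := ⌊(n : ℝ) - 1 + c⌋₊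
    have hj : j ∈ Finset.range (n - 1) := by
      rw [Finset.mem_range]
      have : (j : ℝ) + 1 < n := by linarith
      have : j + 1 < n := by exact_mod_cast this
      lia
    refine le_trans ?_ (Finset.single_le_sum p2 hj)
    rw [if_pos (by linarith), ← Even.neg_pow (even_two_mul k)]
    refine pow_le_pow_left₀ ?_ ?_ _
    · rw [← neg_div]
      exact div_nonneg (by linarith) hn'.le
    · rw [← neg_div, div_le_iff₀ hn', sub_mul, div_mul_cancel₀ _ hn'.ne']
      linarith

theorem choose_mul_pow_le (n j : ℕ) :
    ((n.choose j * n ^ j : ℕ) : ℝ) ≤ ((n : ℝ) ^ 2) ^ j / j.factorial := by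
  push_cast
  have := Nat.choose_le_pow_div (α := ℝ) j n
  calc (n.choose j : ℝ) * (n : ℝ) ^ j ≤ (n : ℝ) ^ j / j.factorial * (n : ℝ) ^ j := by gcongr
    _ = _ := by rw [← pow_mul, two_mul, pow_add]; ring

theorem choose_mul_pow_mul_pow_le {n j k : ℕ} (hj : j ≤ n) (hn : 0 < n) :
    ((n.choose j * n ^ j : ℕ) : ℝ) * (1 - j / (n : ℝ)) ^ (2 * k) ≤
      ((n : ℝ) ^ 2 * Real.exp (-(2 * k / n))) ^ j / j.factorial := by
  have hn' : (0 : ℝ) < n := by exact_mod_cast hn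
  have h1 : (1 - j / (n : ℝ)) ^ (2 * k) ≤ Real.exp (-(2 * k / n)) ^ j := by
    have h0 : 0 ≤ 1 - j / (n : ℝ) := by
      rw [sub_nonneg, div_le_one hn']; exact_mod_cast hj
    refine (pow_le_pow_left₀ h0 (Real.one_sub_le_exp_neg _) _).trans (le_of_eq ?_)
    rw [← Real.exp_nat_mul, ← Real.exp_nat_mul]
    congr 1
    push_cast
    field_simp
  calc _ ≤ ((n : ℝ) ^ 2) ^ j / j.factorial * Real.exp (-(2 * k / n)) ^ j := by
        refine mul_le_mul (choose_mul_pow_le n j) h1 (Even.pow_nonneg (even_two_mul k) _)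
          (by positivity)
    _ = _ := by rw [mul_pow]; ring

/-- The `ℓ²` distance of the star transposition walk to the uniform distribution. -/
theorem sum_starLaw_sub_sq_le (t : α) {k : ℕ} (hk : 0 < k) :
    (Fintype.card α).factorial *
        ∑ x, (starLaw t k x - 1 / ((Fintype.card α).factorial : ℝ)) ^ 2 ≤
      (1 + Real.exp (-(2 * k / Fintype.card α)) ^ 2) *
        Real.exp ((Fintype.card α : ℝ) ^ 2 * Real.exp (-(2 * k / Fintype.card α))) - 1 := by
  have hsym := starSum_isSymmetric (inner_regularRep (α := α)) (Finset.univ.erase t) t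
  set b := hsym.eigenvectorBasis rfl
  set c := hsym.eigenvalues rfl
  have hb : ∀ i, starSum regularRep (Finset.univ.erase t) t (b i) = c i • b i :=
    hsym.apply_eigenvectorBasis rfl
  have hn : 0 < Fintype.card α := Fintype.card_pos_iff.2 ⟨t⟩
  have hn' : (0 : ℝ) < Fintype.card α := by exact_mod_cast hn
  have hb' : ∀ i, starSum regularRep (Finset.univ.erase t) t (signTwist (b i)) =
      (-c i) • signTwist (b i) := by
    intro i
    rw [starSum_signTwist, hb, map_smul, neg_smul]
  have hli : LinearIndependent ℝ b := b.orthonormal.linearIndependent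
  have hli' : LinearIndependent ℝ fun i => signTwist (b i) :=
    hli.map' signTwist (LinearMap.ker_eq_bot.2 signTwist_injective)
  rw [sum_starLaw_sub_sq t k hb]
  set n := Fintype.card α
  set y := (n : ℝ) ^ 2 * Real.exp (-(2 * k / n))
  have hy : 0 ≤ y := by positivity
  refine sub_le_sub_right ?_ _
  calc ∑ i, ((c i + 1) / n) ^ (2 * k)
      ≤ ∑ i, (∑ j ∈ Finset.range n,
          (if (n : ℝ) - 2 - j < c i then (1 - j / (n : ℝ)) ^ (2 * k) else 0) +
          ∑ j ∈ Finset.range (n - 1),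
          (if (n : ℝ) - 2 - j < -c i then (1 - (j + 2) / (n : ℝ)) ^ (2 * k) else 0)) :=
        Finset.sum_le_sum fun i _ => pow_eigenvalue_le_sum hn hk
          (norm_eigenvalue_le t (b.orthonormal.ne_zero i) (hb i))
    _ = ∑ j ∈ Finset.range n,
          ((Finset.univ.filter fun i => (n : ℝ) - 2 - j < c i).card : ℝ) *
            (1 - j / (n : ℝ)) ^ (2 * k) +
        ∑ j ∈ Finset.range (n - 1),
          ((Finset.univ.filter fun i => (n : ℝ) - 2 - j < -c i).card : ℝ) *
            (1 - (j + 2) / (n : ℝ)) ^ (2 * k) := by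
        rw [Finset.sum_add_distrib, Finset.sum_comm, Finset.sum_comm (s := Finset.univ)]
        simp [Finset.sum_ite]
    -- The term `j = 0` of the first sum accounts for the trivial eigenvalue, to be cancelled by the
    -- `-1`. The shift `j + 2` produces the extra factor in the second sum.
    _ ≤ ∑ j ∈ Finset.range n, y ^ j / j.factorial +
        ∑ j ∈ Finset.range (n - 1),
          Real.exp (-(2 * k / n)) ^ 2 * (y ^ j / j.factorial) := by
        refine add_le_add (Finset.sum_le_sum fun j hj => ?_) (Finset.sum_le_sum fun j hj => ?_)
        · rw [Finset.mem_range] at hj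
          refine le_trans ?_ (choose_mul_pow_mul_pow_le hj.le hn)
          refine mul_le_mul_of_nonneg_right ?_ (Even.pow_nonneg (even_two_mul k) _)
          exact_mod_cast card_eigenvalue_gt_le hj t hli hb
        · rw [Finset.mem_range] at hj
          have hjn : (j : ℝ) + 2 ≤ n := by
            have : j + 2 ≤ n := by lia
            exact_mod_cast this
          have h1 : (1 - (j + 2) / (n : ℝ)) ^ (2 * k) ≤
              Real.exp (-(2 * k / n)) ^ 2 * Real.exp (-(2 * k / n)) ^ j := by
            have h0 : 0 ≤ 1 - (j + 2) / (n : ℝ) := by rwa [sub_nonneg, div_le_one hn']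
            refine (pow_le_pow_left₀ h0 (Real.one_sub_le_exp_neg _) _).trans (le_of_eq ?_)
            rw [← pow_add, ← Real.exp_nat_mul, ← Real.exp_nat_mul]
            congr 1
            push_cast
            field_simp
            ring
          have h2 : ((Finset.univ.filter fun i => (n : ℝ) - 2 - j < -c i).card : ℝ) ≤
              ((n : ℝ) ^ 2) ^ j / j.factorial :=
            le_trans (Nat.cast_le.2 (card_eigenvalue_gt_le (by lia) t hli' hb'))
              (choose_mul_pow_le n j)
          refine (mul_le_mul h2 h1 (Even.pow_nonneg (even_two_mul k) _)
            (by positivity)).trans (le_of_eq ?_)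
          rw [mul_pow]
          ring
    _ ≤ Real.exp y + Real.exp (-(2 * k / n)) ^ 2 * Real.exp y := by
        rw [← Finset.mul_sum]
        gcongr
        · exact Real.sum_le_exp_of_nonneg hy n
        · exact Real.sum_le_exp_of_nonneg hy (n - 1)
    _ = _ := by ring

end StarSum

/-! ### Averages over words of independent uniform letters -/

namespace WordAverage

variable {ι : Type*} [Fintype ι]

/-- The expectation of `f` at a word of `k` independent uniform letters. -/
noncomputable def avg : ℕ → (List ι → ℝ) → ℝ
  | 0, f => f []
  | k + 1, f => (Fintype.card ι : ℝ)⁻¹ * ∑ i, avg k fun l => f (i :: l)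

theorem avg_add (k : ℕ) (f g : List ι → ℝ) :
    avg k (fun l => f l + g l) = avg k f + avg k g := by
  induction k generalizing f g with
  | zero => rfl
  | succ k ih => simp only [avg, ih, Finset.sum_add_distrib, mul_add]

theorem avg_const_mul (k : ℕ) (c : ℝ) (f : List ι → ℝ) :
    avg k (fun l => c * f l) = c * avg k f := by
  induction k generalizing f with
  | zero => rfl
  | succ k ih => simp only [avg, ih, ← Finset.mul_sum]; ring

theorem avg_zero (k : ℕ) : avg k (fun _ : List ι => (0 : ℝ)) = 0 := by
  simpa using avg_const_mul k 0 fun _ : List ι => (0 : ℝ)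

theorem avg_sum {κ : Type*} (s : Finset κ) (k : ℕ) (f : κ → List ι → ℝ) :
    avg k (fun l => ∑ a ∈ s, f a l) = ∑ a ∈ s, avg k (f a) := by
  classical
  induction s using Finset.induction_on with
  | empty => simp [avg_zero]
  | insert a s ha ih => simp only [Finset.sum_insert ha, avg_add, ih]

theorem avg_mono (k : ℕ) {f g : List ι → ℝ} (h : ∀ l, f l ≤ g l) : avg k f ≤ avg k g := by
  induction k generalizing f g with
  | zero => exact h []
  | succ k ih =>
    simp only [avg]
    gcongr with i
    exact ih fun l => h _

theorem avg_nonneg (k : ℕ) {f : List ι → ℝ} (h : ∀ l, 0 ≤ f l) : 0 ≤ avg k f :=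
  (avg_zero (ι := ι) k).symm.le.trans (avg_mono k h)

theorem avg_const [Nonempty ι] (k : ℕ) (c : ℝ) : avg k (fun _ : List ι => c) = c := by
  induction k with
  | zero => rfl
  | succ k ih => simp [avg, ih]

theorem avg_succ (k : ℕ) (f : List ι → ℝ) :
    avg (k + 1) f = (Fintype.card ι : ℝ)⁻¹ * avg k fun l => ∑ i, f (i :: l) := by
  rw [avg_sum]; rfl

variable [DecidableEq ι]

theorem avg_notMem [Nonempty ι] (k : ℕ) (j : ι) :
    avg k (fun l => if j ∉ l then (1 : ℝ) else 0) = (1 - 1 / Fintype.card ι) ^ k := by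
  have hn : (Fintype.card ι : ℝ) ≠ 0 := by simp
  induction k with
  | zero => simp [avg]
  | succ k ih =>
    have h : ∀ l : List ι, ∑ i, (if j ∉ i :: l then (1 : ℝ) else 0) =
        (Fintype.card ι - 1) * if j ∉ l then 1 else 0 := by
      intro l
      by_cases hl : j ∈ l
      · simp [hl]
      · simp only [List.mem_cons, hl, or_false, not_false_eq_true, if_true, mul_one]
        rw [Finset.sum_congr rfl (g := fun i => 1 - if j = i then (1 : ℝ) else 0)
          fun i _ => by split_ifs <;> simp_all]
        simp
    rw [avg_succ]
    simp only [h]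
    rw [avg_const_mul, ih, pow_succ]
    field_simp

theorem avg_notMem_mul_notMem [Nonempty ι] (k : ℕ) {j j' : ι} (hj : j ≠ j') :
    avg k (fun l => (if j ∉ l then (1 : ℝ) else 0) * if j' ∉ l then (1 : ℝ) else 0) =
      (1 - 2 / Fintype.card ι) ^ k := by
  have hn : (Fintype.card ι : ℝ) ≠ 0 := by simp
  induction k with
  | zero => simp [avg]
  | succ k ih =>
    have h : ∀ l : List ι, ∑ i, (if j ∉ i :: l then (1 : ℝ) else 0) *
        (if j' ∉ i :: l then (1 : ℝ) else 0) =
        (Fintype.card ι - 2) * ((if j ∉ l then 1 else 0) * if j' ∉ l then 1 else 0) := by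
      intro l
      by_cases hl : j ∈ l
      · simp [hl]
      by_cases hl' : j' ∈ l
      · simp [hl']
      simp only [List.mem_cons, hl, hl', or_false, not_false_eq_true, if_true, mul_one]
      rw [Finset.sum_congr rfl (g := fun i => 1 - (if j = i then (1 : ℝ) else 0) -
        if j' = i then (1 : ℝ) else 0) fun i _ => by
          by_cases h1 : j = i <;> by_cases h2 : j' = i <;> simp_all]
      simp
      ring
    rw [avg_succ]
    simp only [h]
    rw [avg_const_mul, ih, pow_succ]
    field_simp

/-- The number of letters other than `t` that a word misses. -/
def missing (t : ι) (l : List ι) : ℕ := ((Finset.univ.erase t).filter fun j => j ∉ l).card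

theorem missing_eq_sum (t : ι) (l : List ι) :
    (missing t l : ℝ) = ∑ j ∈ Finset.univ.erase t, if j ∉ l then (1 : ℝ) else 0 := by
  rw [missing, Finset.sum_boole]

theorem card_univ_erase (t : ι) :
    ((Finset.univ.erase t).card : ℝ) = Fintype.card ι - 1 := by
  rw [Finset.card_erase_of_mem (Finset.mem_univ t), Finset.card_univ,
    Nat.cast_pred (Fintype.card_pos_iff.2 ⟨t⟩)]

theorem avg_missing (t : ι) (k : ℕ) :
    avg k (fun l => (missing t l : ℝ)) =
      ((Fintype.card ι : ℝ) - 1) * (1 - 1 / Fintype.card ι) ^ k := by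
  have : Nonempty ι := ⟨t⟩
  simp only [missing_eq_sum]
  rw [avg_sum]
  simp only [avg_notMem]
  rw [Finset.sum_const, nsmul_eq_mul, card_univ_erase]

/-- The events of missing two distinct letters are negatively correlated, as `1 - 2/n ≤ (1 - 1/n)²`.
Hence the variance is at most the mean. -/
theorem avg_missing_sq_le (t : ι) (k : ℕ) (hn : 2 ≤ Fintype.card ι) :
    avg k (fun l => (missing t l : ℝ) ^ 2) ≤
      avg k (fun l => (missing t l : ℝ)) + avg k (fun l => (missing t l : ℝ)) ^ 2 := by
  have : Nonempty ι := ⟨t⟩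
  have hn' : (2 : ℝ) ≤ Fintype.card ι := by exact_mod_cast hn
  have h0 : (0 : ℝ) ≤ 1 - 2 / Fintype.card ι := by
    rw [sub_nonneg, div_le_one (by linarith)]; exact hn'
  have h1 : (1 : ℝ) - 2 / Fintype.card ι ≤ (1 - 1 / Fintype.card ι) ^ 2 := by
    have : (1 - 1 / (Fintype.card ι : ℝ)) ^ 2 =
      1 - 2 / Fintype.card ι + (1 / (Fintype.card ι : ℝ)) ^ 2 := by ring
    rw [this]
    exact le_add_of_nonneg_right (sq_nonneg _)
  have h2 : ∀ j j' : ι, avg k (fun l => (if j ∉ l then (1 : ℝ) else 0) *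
      if j' ∉ l then (1 : ℝ) else 0) ≤
      (if j = j' then (1 - 1 / (Fintype.card ι : ℝ)) ^ k else 0) +
        ((1 - 1 / (Fintype.card ι : ℝ)) ^ k) ^ 2 := by
    intro j j'
    by_cases hj : j = j'
    · subst hj
      have : ∀ l : List ι, (if j ∉ l then (1 : ℝ) else 0) * (if j ∉ l then (1 : ℝ) else 0) =
          if j ∉ l then (1 : ℝ) else 0 := fun l => by split_ifs <;> simp
      simp only [this]
      rw [avg_notMem, if_pos trivial]
      exact le_add_of_nonneg_right (sq_nonneg _)
    · rw [avg_notMem_mul_notMem k hj, if_neg hj, zero_add, ← pow_mul, mul_comm k, pow_mul]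
      exact pow_le_pow_left₀ h0 h1 k
  have h3 : ∀ l : List ι, (missing t l : ℝ) ^ 2 = ∑ j ∈ Finset.univ.erase t,
      ∑ j' ∈ Finset.univ.erase t, (if j ∉ l then (1 : ℝ) else 0) *
        if j' ∉ l then (1 : ℝ) else 0 := by
    intro l
    rw [missing_eq_sum, sq, Finset.sum_mul_sum]
  simp only [h3]
  rw [avg_sum]
  simp only [avg_sum]
  refine (Finset.sum_le_sum fun j _ => Finset.sum_le_sum fun j' _ => h2 j j').trans (le_of_eq ?_)
  rw [avg_missing]
  simp only [Finset.sum_add_distrib, Finset.sum_const, nsmul_eq_mul, card_univ_erase,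
    Finset.sum_ite_eq]
  rw [Finset.sum_congr rfl (g := fun _ => (1 - 1 / (Fintype.card ι : ℝ)) ^ k)
    fun j hj => by simp only [if_pos hj]]
  rw [Finset.sum_const, nsmul_eq_mul, card_univ_erase]
  ring

/-- A word misses at least half of the expected number of letters with high probability. -/
theorem le_avg_half_le_missing (t : ι) (k : ℕ) (hn : 2 ≤ Fintype.card ι) {m : ℝ}
    (hm : m = ((Fintype.card ι : ℝ) - 1) * (1 - 1 / Fintype.card ι) ^ k) (hm0 : 0 < m) :
    1 - 4 / m ≤ avg k (fun l => if m / 2 ≤ missing t l then (1 : ℝ) else 0) := by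
  have : Nonempty ι := ⟨t⟩
  have hE : avg k (fun l => (missing t l : ℝ)) = m := by rw [avg_missing, hm]
  have hE2 := avg_missing_sq_le t k hn
  rw [hE] at hE2
  -- Chebyshev's inequality in pointwise form: `1 - (4/m²)(X - m)²` is at most the indicator of `X ≥
  -- m/2`, with the square expanded so that linearity applies.
  have hpt : ∀ l : List ι, 1 + (-(4 / m ^ 2)) * ((missing t l : ℝ) ^ 2 +
      ((-(2 * m)) * (missing t l : ℝ) + m ^ 2)) ≤
      if m / 2 ≤ missing t l then (1 : ℝ) else 0 := by
    intro l
    have e : (missing t l : ℝ) ^ 2 + ((-(2 * m)) * (missing t l : ℝ) + m ^ 2) =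
        (m - missing t l) ^ 2 := by ring
    rw [e]
    split_ifs with h
    · have : 0 ≤ 4 / m ^ 2 * (m - missing t l) ^ 2 := by positivity
      linarith
    · have h1 : (m / 2) ^ 2 ≤ (m - missing t l) ^ 2 :=
        pow_le_pow_left₀ (by linarith) (by linarith) 2
      have h2 : 4 / m ^ 2 * (m / 2) ^ 2 = 1 := by field_simp; norm_num
      have h3 := mul_le_mul_of_nonneg_left h1 (show 0 ≤ 4 / m ^ 2 by positivity)
      linarith
  refine le_trans ?_ (avg_mono k hpt)
  rw [avg_add, avg_const, avg_const_mul, avg_add, avg_add, avg_const_mul, avg_const, hE]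
  have h4 : 4 / m ^ 2 * m = 4 / m := by field_simp
  have h5 : avg k (fun l => (missing t l : ℝ) ^ 2) + (-(2 * m) * m + m ^ 2) ≤ m := by
    linarith [sq m]
  have h6 := mul_le_mul_of_nonneg_left h5 (show 0 ≤ 4 / m ^ 2 by positivity)
  linarith

/-- The letters of a word that occur at or after the first occurrence of `t`; words are read from
right to left. -/
def active (t : ι) : List ι → Finset ι
  | [] => ∅
  | i :: l => if i = t ∨ t ∈ active t l then insert i (active t l) else active t l

theorem active_eq_empty {κ : Type*} [DecidableEq κ] {t : κ} {l : List κ}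
    (h : t ∉ active t l) : active t l = ∅ := by
  induction l with
  | nil => rfl
  | cons i l ih =>
    rw [active] at h ⊢
    split_ifs at h ⊢ with hi
    · rcases hi with rfl | hi
      · simp at h
      · exact absurd (Finset.mem_insert_of_mem hi) h
    · exact ih h

theorem avg_notMem_active_self (t : ι) (k : ℕ) :
    avg k (fun l => if t ∉ active t l then (1 : ℝ) else 0) = (1 - 1 / Fintype.card ι) ^ k := by
  have : Nonempty ι := ⟨t⟩
  rw [← avg_notMem k t]
  congr 1
  ext l
  have : t ∈ active t l ↔ t ∈ l := by
    induction l with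
    | nil => simp [active]
    | cons i l ih =>
      rw [active, List.mem_cons, ← ih]
      split_ifs with hi
      · rw [Finset.mem_insert]
      · rw [not_or] at hi
        simp [hi.2, Ne.symm hi.1]
  simp only [this]

/-- For `j ≠ t` the probabilities satisfy `p (k+1) ≤ (1 - 1/n) p k + (1/n) q k`, where `q k = (1 -
1/n)^k` is the probability that `t` has not occurred. The factor `2` comes from `q k ≤ 2 q (k+1)`,
valid for `n ≥ 2`. -/
theorem avg_notMem_active_le (t j : ι) (k : ℕ) (hn : 2 ≤ Fintype.card ι) :
    avg k (fun l => if j ∉ active t l then (1 : ℝ) else 0) ≤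
      (1 + 2 * k / Fintype.card ι) * (1 - 1 / Fintype.card ι) ^ k := by
  have hn' : (2 : ℝ) ≤ Fintype.card ι := by exact_mod_cast hn
  have hρ : (1 : ℝ) / 2 ≤ 1 - 1 / Fintype.card ι := by
    have : 1 / (Fintype.card ι : ℝ) ≤ 1 / 2 := one_div_le_one_div_of_le (by norm_num) hn'
    linarith
  by_cases hj : j = t
  · subst hj
    rw [avg_notMem_active_self]
    refine le_mul_of_one_le_left (pow_nonneg (by linarith) _) ?_
    have : (0 : ℝ) ≤ 2 * k / Fintype.card ι := by positivity
    linarith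
  induction k with
  | zero => simp [avg, active]
  | succ k ih =>
    have h : ∀ l : List ι, ∑ i, (if j ∉ active t (i :: l) then (1 : ℝ) else 0) ≤
        (Fintype.card ι - 1) * (if j ∉ active t l then 1 else 0) +
          if t ∉ active t l then (1 : ℝ) else 0 := by
      intro l
      by_cases ht : t ∈ active t l
      · simp only [active, ht, or_true, if_true, Finset.mem_insert, not_true_eq_false, if_false,
          add_zero]
        by_cases hl : j ∈ active t l
        · simp [hl]
        · simp only [hl, or_false, not_false_eq_true, if_true, mul_one]
          rw [Finset.sum_congr rfl (g := fun i => 1 - if j = i then (1 : ℝ) else 0)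
            fun i _ => by split_ifs <;> simp_all]
          simp
      · have hl := active_eq_empty ht
        rw [hl]
        simp only [Finset.notMem_empty, not_false_eq_true, if_true]
        refine (Finset.sum_le_sum (g := fun _ => (1 : ℝ)) fun i _ => ?_).trans (by simp)
        split_ifs <;> norm_num
    rw [avg_succ]
    calc _ ≤ (Fintype.card ι : ℝ)⁻¹ * ((Fintype.card ι - 1) *
          ((1 + 2 * k / Fintype.card ι) * (1 - 1 / Fintype.card ι) ^ k) +
            (1 - 1 / Fintype.card ι) ^ k) := by
          refine mul_le_mul_of_nonneg_left ((avg_mono k h).trans ?_) (by positivity)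
          rw [avg_add, avg_const_mul, avg_notMem_active_self]
          gcongr
          linarith
      _ = (1 + 2 * k / Fintype.card ι) * (1 - 1 / Fintype.card ι) ^ (k + 1) +
            1 / Fintype.card ι * (1 - 1 / Fintype.card ι) ^ k := by
          rw [pow_succ]; field_simp
      _ ≤ (1 + 2 * k / Fintype.card ι) * (1 - 1 / Fintype.card ι) ^ (k + 1) +
            1 / Fintype.card ι * (2 * (1 - 1 / Fintype.card ι) ^ (k + 1)) := by
          gcongr
          rw [pow_succ]
          have : (0 : ℝ) ≤ (1 - 1 / Fintype.card ι) ^ k := pow_nonneg (by linarith) _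
          nlinarith
      _ = _ := by push_cast; ring

theorem avg_active_ne_univ_le (t : ι) (k : ℕ) (hn : 2 ≤ Fintype.card ι) :
    avg k (fun l => if active t l = Finset.univ then (0 : ℝ) else 1) ≤
      (Fintype.card ι + 2 * k) * Real.exp (-(k / Fintype.card ι)) := by
  have hn' : (2 : ℝ) ≤ Fintype.card ι := by exact_mod_cast hn
  have hpt : ∀ l : List ι, (if active t l = Finset.univ then (0 : ℝ) else 1) ≤
      ∑ j, if j ∉ active t l then (1 : ℝ) else 0 := by
    intro l
    have hnn : ∀ j ∈ (Finset.univ : Finset ι), (0 : ℝ) ≤ if j ∉ active t l then (1 : ℝ) else 0 :=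
      fun j _ => by split_ifs <;> norm_num
    split_ifs with h
    · exact Finset.sum_nonneg hnn
    · obtain ⟨j, hj⟩ : ∃ j, j ∉ active t l := by
        by_contra! H
        exact h (Finset.eq_univ_iff_forall.2 H)
      exact le_trans (by rw [if_pos hj]) (Finset.single_le_sum hnn (Finset.mem_univ j))
  refine (avg_mono k hpt).trans ?_
  rw [avg_sum]
  refine (Finset.sum_le_sum fun j _ => avg_notMem_active_le t j k hn).trans ?_
  rw [Finset.sum_const, Finset.card_univ, nsmul_eq_mul]
  have h0 : (0 : ℝ) ≤ 1 - 1 / Fintype.card ι := by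
    rw [sub_nonneg, div_le_one (by linarith)]; linarith
  have h1 : (1 - 1 / (Fintype.card ι : ℝ)) ^ k ≤ Real.exp (-(k / Fintype.card ι)) := by
    refine (pow_le_pow_left₀ h0 (Real.one_sub_le_exp_neg _) k).trans (le_of_eq ?_)
    rw [← Real.exp_nat_mul]
    congr 1
    ring
  calc _ = ((Fintype.card ι : ℝ) + 2 * k) * (1 - 1 / (Fintype.card ι : ℝ)) ^ k := by field_simp
    _ ≤ _ := by gcongr

end WordAverage

namespace RandomWalk

/-! ### General facts on random walks on finite groups -/

theorem abs_sum_sub_le_sum_pos {Ω : Type*} [Fintype Ω] {μ ν : Ω → ℝ}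
    (h : ∑ x, μ x = ∑ x, ν x) (A : Finset Ω) :
    |∑ x ∈ A, μ x - ∑ x ∈ A, ν x| ≤ ∑ x, max (ν x - μ x) 0 := by
  classical
  have hB : ∀ B : Finset Ω, ∑ x ∈ B, ν x - ∑ x ∈ B, μ x ≤ ∑ x, max (ν x - μ x) 0 := by
    intro B
    rw [← Finset.sum_sub_distrib]
    calc _ ≤ ∑ x ∈ B, max (ν x - μ x) 0 := Finset.sum_le_sum fun x _ => le_max_left _ _
      _ ≤ _ := Finset.sum_le_sum_of_subset_of_nonneg (Finset.subset_univ _)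
          fun x _ _ => le_max_right _ _
  rw [abs_le]
  have h1 := hB A
  have h2 := hB Aᶜ
  have h3 := Finset.sum_add_sum_compl A μ
  have h4 := Finset.sum_add_sum_compl A ν
  constructor <;> linarith

/-- Only the deficit of `μ` below `ν` enters, so a lower bound for the law of the walk suffices. -/
theorem tvDist_le_sum_pos {Ω : Type*} [Fintype Ω] {μ ν : Ω → ℝ}
    (h : ∑ x, μ x = ∑ x, ν x) : tvDist μ ν ≤ ∑ x, max (ν x - μ x) 0 :=
  ciSup_le fun A => abs_sum_sub_le_sum_pos h A

theorem tvDist_nonneg {Ω : Type*} (μ ν : Ω → ℝ) : 0 ≤ tvDist μ ν :=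
  Real.iSup_nonneg fun _ => abs_nonneg _

theorem sub_le_tvDist {Ω : Type*} [Fintype Ω] (μ ν : Ω → ℝ) (A : Finset Ω) :
    ∑ x ∈ A, μ x - ∑ x ∈ A, ν x ≤ tvDist μ ν :=
  (le_abs_self _).trans (le_ciSup (f := fun A : Finset Ω => |∑ x ∈ A, μ x - ∑ x ∈ A, ν x|)
    (Set.finite_range _).bddAbove A)

theorem tvDist_le_one {Ω : Type*} [Fintype Ω] {μ ν : Ω → ℝ} (hμ : IsProb μ) (hν : IsProb ν) :
    tvDist μ ν ≤ 1 := by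
  refine (tvDist_le_sum_pos (hμ.2.trans hν.2.symm)).trans ?_
  rw [← hν.2]
  exact Finset.sum_le_sum fun x _ => max_le (by linarith [hμ.1 x]) (hν.1 x)

theorem isProb_unif (Ω : Type*) [Fintype Ω] [Nonempty Ω] : IsProb (unif Ω) := by
  refine ⟨fun x => ?_, ?_⟩
  · unfold unif; positivity
  · simp [unif]

section Group

variable {G : Type*} [Group G] [Fintype G]

theorem conv_apply (p q : G → ℝ) (x : G) : conv p q x = ∑ y, p y * q (y⁻¹ * x) := by
  rw [conv, ← Equiv.sum_comp ((Equiv.inv G).trans (Equiv.mulRight x))]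
  refine Finset.sum_congr rfl fun y _ => ?_
  simp

theorem isProb_conv {p q : G → ℝ} (hp : IsProb p) (hq : IsProb q) : IsProb (conv p q) := by
  refine ⟨fun x => Finset.sum_nonneg fun y _ => mul_nonneg (hp.1 _) (hq.1 _), ?_⟩
  simp only [conv_apply]
  rw [Finset.sum_comm]
  simp only [← Finset.mul_sum]
  have : ∀ y : G, ∑ x, q (y⁻¹ * x) = 1 := fun y => by
    rw [← hq.2]
    exact Equiv.sum_comp (Equiv.mulLeft y⁻¹) q
  simp [this, hp.2]

theorem isProb_convPow {p : G → ℝ} (hp : IsProb p) (k : ℕ) : IsProb (convPow p k) := by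
  induction k with
  | zero =>
    refine ⟨fun x => ?_, ?_⟩
    · simp only [convPow]
      split_ifs <;> norm_num
    · rw [Finset.sum_eq_single 1]
      · simp [convPow]
      · intro x _ hx
        simp [convPow, hx]
      · simp
  | succ k ih => exact isProb_conv hp ih

open Classical in
theorem transition_pow_nonneg {p : G → ℝ} (hp : ∀ x, 0 ≤ p x) (k : ℕ) (x y : G) :
    0 ≤ (transition p ^ k) x y := by
  induction k generalizing y with
  | zero => rw [pow_zero, Matrix.one_apply]; split_ifs <;> norm_num
  | succ k ih =>
    rw [pow_succ, Matrix.mul_apply]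
    exact Finset.sum_nonneg fun z _ => mul_nonneg (ih z) (hp _)

/-- In a finite group the submonoid generated by the support is already a subgroup, so inverses of
steps are not needed. -/
theorem isIrred_transition {p : G → ℝ} (hp : ∀ x, 0 ≤ p x)
    (hgen : Subgroup.closure (Function.support p) = ⊤) : IsIrred (transition p) := by
  classical
  have key : ∀ g ∈ Submonoid.closure (Function.support p),
      ∀ x, ∃ k : ℕ, 0 < (transition p ^ k) x (x * g) := by
    intro g hg
    induction hg using Submonoid.closure_induction with
    | mem g hg =>
      intro x
      refine ⟨1, ?_⟩
      rw [pow_one, transition, Matrix.of_apply, inv_mul_cancel_left]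
      exact lt_of_le_of_ne (hp g) (Ne.symm hg)
    | one => exact fun x => ⟨0, by simp⟩
    | mul g h _ _ hg hh =>
      intro x
      obtain ⟨k, hk⟩ := hg x
      obtain ⟨m, hm⟩ := hh (x * g)
      refine ⟨k + m, ?_⟩
      rw [pow_add, Matrix.mul_apply, ← mul_assoc]
      exact Finset.sum_pos' (fun z _ => mul_nonneg (transition_pow_nonneg hp _ _ _)
        (transition_pow_nonneg hp _ _ _)) ⟨x * g, Finset.mem_univ _, mul_pos hk hm⟩
  intro x y
  have hy : x⁻¹ * y ∈ Submonoid.closure (Function.support p) := by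
    rw [← Subgroup.closure_toSubmonoid_of_finite, hgen]
    trivial
  obtain ⟨k, hk⟩ := key _ hy x
  refine ⟨k, ?_⟩
  rw [mul_inv_cancel_left] at hk
  convert hk

theorem isAperiodic_transition {p : G → ℝ} (h1 : 0 < p 1) : IsAperiodic (transition p) := by
  classical
  intro x d hd
  refine Nat.dvd_one.1 (hd 1 ⟨le_rfl, ?_⟩)
  rw [pow_one, transition, Matrix.of_apply, inv_mul_cancel]
  exact h1

end Group

end RandomWalk

/-! ### Reduction of the shuffle to its word of places -/

namespace Monomial

open RandomWalk WordAverage StarSum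

variable {G : Type*} [Group G] {n : ℕ}

theorem sum_eq_sum_sum [Fintype G] (f : Monomial G n → ℝ) :
    ∑ x, f x = ∑ π : Equiv.Perm (Fin n), ∑ z : Fin n → G, f ⟨z, π⟩ := by
  rw [← Equiv.sum_comp SemidirectProduct.equivProd.symm f, Fintype.sum_prod_type,
    Finset.sum_comm]
  rfl

theorem card_monomial [Fintype G] :
    (Fintype.card (Monomial G n) : ℝ) = (Fintype.card G : ℝ) ^ n * n.factorial := by
  have h : Fintype.card (Monomial G n) =
      Fintype.card ((Fin n → G) × Equiv.Perm (Fin n)) :=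
    Fintype.card_congr SemidirectProduct.equivProd
  rw [h, Fintype.card_prod, Fintype.card_perm]
  simp

variable [NeZero n]

/-- The increment of the shuffle that picks the place `i` and the group element `a`. -/
def step (i : Fin n) (a : G) : Monomial G n := if i = ⊤ then lastElt a else warpElt i a

theorem step_right (i : Fin n) (a : G) : (step i a).right = Equiv.swap i ⊤ := by
  unfold step
  split_ifs with h
  · rw [h, Equiv.swap_self]; rfl
  · rfl

theorem step_left_top (i : Fin n) (a : G) : (step i a).left ⊤ = a := by
  unfold step
  split_ifs with h
  · simp [lastElt]
  · simp [warpElt, Ne.symm h]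

theorem step_injective :
    Function.Injective (fun q : Fin n × G => step q.1 q.2) := by
  rintro ⟨i, a⟩ ⟨j, b⟩ h
  have h1 := congrArg (fun x : Monomial G n => x.right ⊤) h
  have h2 := congrArg (fun x : Monomial G n => x.left ⊤) h
  simp only [step_right, Equiv.swap_apply_right] at h1
  simp only [step_left_top] at h2
  rw [h1, h2]

theorem lastElt_inv_mul (a : G) (z : Fin n → G) (π : Equiv.Perm (Fin n)) :
    (lastElt a : Monomial G n)⁻¹ * ⟨z, π⟩ = ⟨Function.update z ⊤ (a⁻¹ * z ⊤), π⟩ := by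
  rw [inv_mul_eq_iff_eq_mul, lastElt, mul_eq]
  have h1 : ∀ j, (1 : Equiv.Perm (Fin n))⁻¹ j = j := fun _ => rfl
  simp only [h1]
  ext j
  · by_cases hj : j = ⊤
    · subst hj; simp
    · simp [hj]
  · simp

theorem warpElt_inv_mul {i : Fin n} (hi : i ≠ ⊤) (a : G) (z : Fin n → G)
    (π : Equiv.Perm (Fin n)) :
    (warpElt i a : Monomial G n)⁻¹ * ⟨z, π⟩ =
      ⟨Function.update (Function.update z i (a⁻¹ * z ⊤)) ⊤ (a * z i),
        Equiv.swap i ⊤ * π⟩ := by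
  rw [inv_mul_eq_iff_eq_mul, warpElt, mul_eq]
  ext j
  · by_cases hj : j = ⊤
    · subst hj
      simp [hi, Ne.symm hi]
    · by_cases hji : j = i
      · subst hji
        simp [hj]
      · simp [hj, hji, Equiv.swap_apply_of_ne_of_ne hji hj]
  · simp

variable [Fintype G]

open Classical in
/-- The law of the shuffle given the word of places; the last place is the head of the word. -/
noncomputable def placeLaw : List (Fin n) → Monomial G n → ℝ
  | [] => fun x => if x = 1 then 1 else 0
  | i :: l => fun x => (Fintype.card G : ℝ)⁻¹ * ∑ a, placeLaw l ((step i a)⁻¹ * x)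

/-- The permutation of the shuffle given the word of places. -/
def wordPerm : List (Fin n) → Equiv.Perm (Fin n)
  | [] => 1
  | i :: l => Equiv.swap i ⊤ * wordPerm l

open Classical in
theorem warpTranspose_eq_sum (x : Monomial G n) :
    warpTranspose G n x =
      1 / ((n : ℝ) * Fintype.card G) * ∑ i, ∑ a, if step i a = x then 1 else 0 := by
  have hiff : ((∃ g : G, x = lastElt g) ∨ ∃ i : Fin n, i < ⊤ ∧ ∃ g : G, x = warpElt i g) ↔
      ∃ q : Fin n × G, step q.1 q.2 = x := by
    constructor
    · rintro (⟨g, rfl⟩ | ⟨i, hi, g, rfl⟩)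
      · exact ⟨(⊤, g), by simp [step]⟩
      · exact ⟨(i, g), by simp [step, hi.ne]⟩
    · rintro ⟨⟨i, g⟩, rfl⟩
      by_cases hi : i = ⊤
      · exact Or.inl ⟨g, by simp [step, hi]⟩
      · exact Or.inr ⟨i, lt_top_iff_ne_top.2 hi, g, by simp [step, hi]⟩
  rw [warpTranspose, ← Fintype.sum_prod_type' (f := fun i a => if step i a = x then (1 : ℝ) else 0)]
  by_cases hx : ∃ q : Fin n × G, step q.1 q.2 = x
  · rw [if_pos (hiff.2 hx)]
    obtain ⟨q, rfl⟩ := hx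
    rw [Finset.sum_eq_single q]
    · simp
    · intro q' _ hq'
      exact if_neg fun h => hq' (step_injective h)
    · simp
  · rw [if_neg (hiff.not.2 hx), Finset.sum_eq_zero, mul_zero]
    intro q _
    exact if_neg fun h => hx ⟨q, h⟩

theorem sum_warpTranspose_mul (f : Monomial G n → ℝ) :
    ∑ x, warpTranspose G n x * f x =
      1 / ((n : ℝ) * Fintype.card G) * ∑ i, ∑ a, f (step i a) := by
  classical
  simp only [warpTranspose_eq_sum, mul_assoc, Finset.sum_mul]
  rw [← Finset.mul_sum, Finset.sum_comm]
  congr 1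
  refine Finset.sum_congr rfl fun i _ => ?_
  rw [Finset.sum_comm]
  refine Finset.sum_congr rfl fun a _ => ?_
  simp

theorem isProb_warpTranspose : IsProb (warpTranspose G n) := by
  refine ⟨fun x => ?_, ?_⟩
  · rw [warpTranspose]
    split_ifs
    · positivity
    · exact le_rfl
  · have := sum_warpTranspose_mul (G := G) (n := n) fun _ => 1
    simp only [mul_one] at this
    rw [this]
    have hn : (n : ℝ) ≠ 0 := Nat.cast_ne_zero.2 (NeZero.ne n)
    simp only [Finset.sum_const, Finset.card_univ, Fintype.card_fin, nsmul_eq_mul]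
    field_simp

theorem convPow_eq_avg (k : ℕ) (x : Monomial G n) :
    convPow (warpTranspose G n) k x = avg k fun l => placeLaw l x := by
  induction k generalizing x with
  | zero => simp [convPow, avg, placeLaw]
  | succ k ih =>
    rw [convPow, conv_apply, sum_warpTranspose_mul (f := fun y => _)]
    simp only [ih, avg, placeLaw, avg_const_mul, avg_sum, ← Finset.mul_sum, Fintype.card_fin]
    rw [one_div, mul_inv, mul_assoc]

/-- Averaging over the group element at a step makes the coordinate at the chosen place uniform. -/
theorem sum_placeLaw_step {i : Fin n} {l : List (Fin n)}
    (ih : ∀ (π : Equiv.Perm (Fin n)) (z z' : Fin n → G),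
      (∀ j ∉ active ⊤ l, z j = z' j) → placeLaw l ⟨z, π⟩ = placeLaw l ⟨z', π⟩)
    (hi : i = ⊤ ∨ ⊤ ∈ active ⊤ l) (z : Fin n → G) (π : Equiv.Perm (Fin n)) :
    ∑ a, placeLaw l ((step i a)⁻¹ * (⟨z, π⟩ : Monomial G n)) =
      ∑ b, placeLaw l ⟨Function.update z i b, Equiv.swap i ⊤ * π⟩ := by
  -- Substitution `b = a⁻¹ * z ⊤`, the entry that undoing the step puts at place `i`.
  rw [← Equiv.sum_comp ((Equiv.inv G).trans (Equiv.mulRight (z ⊤)))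
    (fun b => placeLaw l ⟨Function.update z i b, Equiv.swap i ⊤ * π⟩)]
  refine Finset.sum_congr rfl fun a _ => ?_
  by_cases hit : i = ⊤
  · subst hit
    rw [step, if_pos rfl, lastElt_inv_mul, Equiv.swap_self]
    rfl
  · rw [step, if_neg hit, warpElt_inv_mul hit]
    -- The two arguments differ only at `⊤`, which is active and therefore irrelevant.
    refine ih _ _ _ fun j hj => ?_
    have : j ≠ ⊤ := fun h => hj (h ▸ hi.resolve_left hit)
    rw [Function.update_of_ne this]
    rfl

/-- Given the places, the coordinates at the active places are independent and uniform. -/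
theorem placeLaw_congr_of_active (l : List (Fin n)) (π : Equiv.Perm (Fin n)) (z z' : Fin n → G)
    (h : ∀ j ∉ active ⊤ l, z j = z' j) : placeLaw l ⟨z, π⟩ = placeLaw l ⟨z', π⟩ := by
  induction l generalizing π z z' with
  | nil =>
    have : z = z' := funext fun j => h j (by simp [active])
    rw [this]
  | cons i l ih =>
    by_cases hi : i = ⊤ ∨ ⊤ ∈ active ⊤ l
    · rw [active, if_pos hi] at h
      simp only [placeLaw]
      rw [sum_placeLaw_step ih hi, sum_placeLaw_step ih hi]
      congr 1
      refine Finset.sum_congr rfl fun b _ => ih _ _ _ fun j hj => ?_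
      by_cases hji : j = i
      · subst hji; simp
      · rw [Function.update_of_ne hji, Function.update_of_ne hji]
        exact h j (by simp [hji, hj])
    · rw [active, if_neg hi, active_eq_empty fun h => hi (Or.inr h)] at h
      have : z = z' := funext fun j => h j (by simp)
      rw [this]

/-- Undoing a fixed step maps the fibre over `π` bijectively onto the fibre over `(i ⊤) π`, so the
group elements drop out and the permutation is determined by the places. -/
theorem sum_placeLaw (l : List (Fin n)) (π : Equiv.Perm (Fin n)) :
    ∑ z : Fin n → G, placeLaw l ⟨z, π⟩ = if wordPerm l = π then 1 else 0 := by
  induction l generalizing π with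
  | nil =>
    rw [show wordPerm ([] : List (Fin n)) = 1 from rfl]
    simp only [placeLaw]
    have : ∀ z : Fin n → G, ((⟨z, π⟩ : Monomial G n) = 1) ↔ z = 1 ∧ 1 = π := by
      intro z
      rw [SemidirectProduct.ext_iff]
      exact and_congr_right fun _ => eq_comm
    rw [Finset.sum_eq_single 1]
    · by_cases hπ : 1 = π
      · rw [if_pos ((this 1).2 ⟨rfl, hπ⟩), if_pos hπ]
      · rw [if_neg fun h => hπ ((this 1).1 h).2, if_neg hπ]
    · exact fun z _ hz => if_neg fun h => hz ((this z).1 h).1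
    · simp
  | cons i l ih =>
    rw [show wordPerm (i :: l) = Equiv.swap i ⊤ * wordPerm l from rfl]
    simp only [placeLaw]
    rw [← Finset.mul_sum, Finset.sum_comm]
    have h : ∀ a : G, ∑ z : Fin n → G, placeLaw l ((step i a)⁻¹ * (⟨z, π⟩ : Monomial G n)) =
        if Equiv.swap i ⊤ * wordPerm l = π then 1 else 0 := by
      intro a
      have hm : ∀ z : Fin n → G, (step i a)⁻¹ * (⟨z, π⟩ : Monomial G n) =
          ⟨((mulAutArrow (A := Fin n) (M := G) (step i a)⁻¹.right).toEquiv.trans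
            (Equiv.mulLeft (step i a)⁻¹.left)) z, Equiv.swap i ⊤ * π⟩ := by
        intro z
        have hr : (step (G := G) i a)⁻¹.right = Equiv.swap i ⊤ := by
          rw [SemidirectProduct.inv_right, step_right, Equiv.swap_inv]
        rw [← hr]
        rfl
      simp only [hm]
      rw [Equiv.sum_comp _ (fun z => placeLaw l (⟨z, Equiv.swap i ⊤ * π⟩ : Monomial G n)), ih]
      congr 1
      refine propext ⟨fun h => ?_, fun h => ?_⟩
      · rw [h, ← mul_assoc, Equiv.swap_mul_self, one_mul]
      · rw [← h, ← mul_assoc, Equiv.swap_mul_self, one_mul]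
    simp only [h]
    split_ifs <;> simp

theorem placeLaw_nonneg (l : List (Fin n)) (x : Monomial G n) : 0 ≤ placeLaw l x := by
  classical
  induction l generalizing x with
  | nil => simp only [placeLaw]; split_ifs <;> norm_num
  | cons i l ih =>
    exact mul_nonneg (by positivity) (Finset.sum_nonneg fun a _ => ih _)

theorem placeLaw_of_active_eq_univ {l : List (Fin n)} (hl : active ⊤ l = Finset.univ)
    (z : Fin n → G) (π : Equiv.Perm (Fin n)) :
    placeLaw l ⟨z, π⟩ = (if wordPerm l = π then 1 else 0) / (Fintype.card G : ℝ) ^ n := by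
  rw [eq_div_iff (by positivity), ← sum_placeLaw (G := G) l π,
    Finset.sum_congr rfl fun z' _ =>
      placeLaw_congr_of_active l π z' z fun j hj => absurd (hl ▸ Finset.mem_univ j) hj]
  simp [mul_comm]

theorem starLaw_eq_avg (k : ℕ) (π : Equiv.Perm (Fin n)) :
    starLaw ⊤ k π = avg k fun l => if wordPerm l = π then 1 else 0 := by
  induction k generalizing π with
  | zero => simp [starLaw, avg, wordPerm, eq_comm]
  | succ k ih =>
    simp only [starLaw, avg, ih, wordPerm]
    congr 1
    refine Finset.sum_congr rfl fun i _ => ?_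
    congr 1
    ext l
    congr 1
    refine propext ⟨fun h => ?_, fun h => ?_⟩
    · rw [h, ← mul_assoc, Equiv.swap_mul_self, one_mul]
    · rw [← h, ← mul_assoc, Equiv.swap_mul_self, one_mul]

/-- The distance of the shuffle to uniformity is controlled by the star transposition walk and the
time at which all places have become active. -/
theorem tvDist_le (k : ℕ) (hn : 2 ≤ n) :
    tvDist (convPow (warpTranspose G n) k) (unif (Monomial G n)) ≤
      ∑ π : Equiv.Perm (Fin n), |starLaw ⊤ k π - 1 / (n.factorial : ℝ)| +
        (n + 2 * k) * Real.exp (-(k / n)) := by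
  have hP := isProb_convPow (isProb_warpTranspose (G := G) (n := n)) k
  have hU := isProb_unif (Monomial G n)
  refine (tvDist_le_sum_pos (hP.2.trans hU.2.symm)).trans ?_
  set c : ℝ := (Fintype.card G : ℝ) ^ n
  have hc : 0 < c := by positivity
  set bad : Equiv.Perm (Fin n) → ℝ := fun π => avg k fun l =>
    (if active ⊤ l = Finset.univ then (0 : ℝ) else 1) * if wordPerm l = π then 1 else 0
  have hbad : ∀ π, 0 ≤ bad π := fun π =>
    avg_nonneg k fun l => mul_nonneg (by split_ifs <;> norm_num) (by split_ifs <;> norm_num)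
  -- Words with all places active give a law uniform on the fibre; the remaining words are estimated
  -- below by zero.
  have hlow : ∀ (π : Equiv.Perm (Fin n)) (z : Fin n → G), (starLaw ⊤ k π - bad π) / c ≤
      convPow (warpTranspose G n) k ⟨z, π⟩ := by
    intro π z
    rw [convPow_eq_avg, starLaw_eq_avg, div_eq_inv_mul, sub_eq_add_neg, ← neg_one_mul (bad π),
      ← avg_const_mul, ← avg_add, ← avg_const_mul]
    refine avg_mono k fun l => ?_
    by_cases hl : active ⊤ l = Finset.univ
    · rw [placeLaw_of_active_eq_univ hl, if_pos hl, div_eq_inv_mul]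
      simp [c]
    · rw [if_neg hl, one_mul, neg_one_mul, add_neg_cancel, mul_zero]
      exact placeLaw_nonneg l _
  have hterm : ∀ (π : Equiv.Perm (Fin n)) (z : Fin n → G),
      max (unif (Monomial G n) ⟨z, π⟩ - convPow (warpTranspose G n) k ⟨z, π⟩) 0 ≤
        (|starLaw ⊤ k π - 1 / (n.factorial : ℝ)| + bad π) / c := by
    intro π z
    refine max_le ?_ (by have := hbad π; positivity)
    have hu : unif (Monomial G n) ⟨z, π⟩ = 1 / (n.factorial : ℝ) / c := by
      rw [unif, card_monomial, div_div, mul_comm]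
    have := hlow π z
    rw [hu]
    calc _ ≤ 1 / (n.factorial : ℝ) / c - (starLaw ⊤ k π - bad π) / c := by linarith
      _ = (-(starLaw ⊤ k π - 1 / (n.factorial : ℝ)) + bad π) / c := by ring
      _ ≤ _ := by gcongr; exact neg_le_abs _
  rw [sum_eq_sum_sum]
  refine (Finset.sum_le_sum fun π _ => Finset.sum_le_sum fun z _ => hterm π z).trans ?_
  have hcard : ∀ a : ℝ, ∑ _z : Fin n → G, a / c = a := by
    intro a
    rw [Finset.sum_const, Finset.card_univ, Fintype.card_fun, Fintype.card_fin, nsmul_eq_mul]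
    push_cast
    exact mul_div_cancel₀ a hc.ne'
  simp only [hcard]
  rw [Finset.sum_add_distrib]
  refine add_le_add le_rfl ?_
  have hsum : ∑ π, bad π = avg k fun l =>
      if active (⊤ : Fin n) l = Finset.univ then (0 : ℝ) else 1 := by
    simp only [bad]
    rw [← avg_sum]
    congr 1
    ext l
    rw [← Finset.mul_sum]
    simp
  rw [hsum]
  simpa using avg_active_ne_univ_le (⊤ : Fin n) k (by simpa using hn)

theorem tvDist_le_sqrt {k : ℕ} (hk : 0 < k) (hn : 2 ≤ n) :
    tvDist (convPow (warpTranspose G n) k) (unif (Monomial G n)) ≤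
      √((1 + Real.exp (-(2 * k / n)) ^ 2) * Real.exp ((n : ℝ) ^ 2 * Real.exp (-(2 * k / n))) - 1) +
        (n + 2 * k) * Real.exp (-(k / n)) := by
  refine (tvDist_le k hn).trans (add_le_add ?_ le_rfl)
  have h := sum_starLaw_sub_sq_le (⊤ : Fin n) hk
  simp only [Fintype.card_fin] at h
  refine Real.le_sqrt_of_sq_le (le_trans ?_ h)
  -- Cauchy–Schwarz over the `n!` permutations supplies the factorial of the `ℓ²` bound.
  have hcs := sq_sum_le_card_mul_sum_sq (s := (Finset.univ : Finset (Equiv.Perm (Fin n))))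
    (f := fun π => |starLaw ⊤ k π - 1 / (n.factorial : ℝ)|)
  simpa [Fintype.card_perm] using hcs

end Monomial

namespace Monomial

open RandomWalk WordAverage StarSum

/-! ### Generation -/

section Generation

variable {G : Type*} [Group G] [Fintype G] {n : ℕ} [NeZero n]

theorem lastElt_mem_support (g : G) :
    (lastElt g : Monomial G n) ∈ Function.support (warpTranspose G n) := by
  have hn : (n : ℝ) ≠ 0 := Nat.cast_ne_zero.2 (NeZero.ne n)
  rw [Function.mem_support, warpTranspose, if_pos (Or.inl ⟨g, rfl⟩)]
  positivity

theorem warpElt_mem_support {i : Fin n} (hi : i ≠ ⊤) (g : G) :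
    (warpElt i g : Monomial G n) ∈ Function.support (warpTranspose G n) := by
  have hn : (n : ℝ) ≠ 0 := Nat.cast_ne_zero.2 (NeZero.ne n)
  rw [Function.mem_support, warpTranspose,
    if_pos (Or.inr ⟨i, lt_top_iff_ne_top.2 hi, g, rfl⟩)]
  positivity

theorem closure_support_warpTranspose :
    Subgroup.closure (Function.support (warpTranspose G n)) = ⊤ := by
  set H := Subgroup.closure (Function.support (warpTranspose G n))
  have hswap : ∀ i : Fin n, i ≠ ⊤ →
      (SemidirectProduct.inr (Equiv.swap i ⊤) : Monomial G n) ∈ H := by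
    intro i hi
    have h := Subgroup.subset_closure (warpElt_mem_support hi (1 : G))
    have e : (warpElt i (1 : G) : Monomial G n) = SemidirectProduct.inr (Equiv.swap i ⊤) := by
      ext j <;> simp [warpElt]
    rwa [e] at h
  have hperm : ∀ π : Equiv.Perm (Fin n), (SemidirectProduct.inr π : Monomial G n) ∈ H := by
    intro π
    have h1 : π ∈ Subgroup.closure
        {τ | ∃ x ∈ Finset.univ.erase (⊤ : Fin n), τ = Equiv.swap x ⊤} := by
      refine mem_closure_star_swaps (by simp) fun d hd => absurd ?_ hd
      by_cases h : d = ⊤ <;> simp [h]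
    have h2 : Subgroup.closure {τ | ∃ x ∈ Finset.univ.erase (⊤ : Fin n), τ = Equiv.swap x ⊤} ≤
        H.comap SemidirectProduct.inr := by
      rw [Subgroup.closure_le]
      rintro _ ⟨x, hx, rfl⟩
      exact hswap x (Finset.ne_of_mem_erase hx)
    exact h2 h1
  have htop : ∀ g : G, (SemidirectProduct.inl (Pi.mulSingle ⊤ g) : Monomial G n) ∈ H :=
    fun g => Subgroup.subset_closure (lastElt_mem_support g)
  have hsingle : ∀ (i : Fin n) (g : G),
      (SemidirectProduct.inl (Pi.mulSingle i g) : Monomial G n) ∈ H := by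
    intro i g
    by_cases hi : i = ⊤
    · rw [hi]; exact htop g
    · have hw := Subgroup.subset_closure (warpElt_mem_support hi g⁻¹)
      -- Undoing the transposition in `warpElt i g⁻¹` leaves `g` at `i` and `g⁻¹` at `⊤`; the last
      -- factor cancels the latter.
      have e : (SemidirectProduct.inl (Pi.mulSingle i g) : Monomial G n) =
          warpElt i g⁻¹ * (SemidirectProduct.inr (Equiv.swap i ⊤))⁻¹ *
            SemidirectProduct.inl (Pi.mulSingle ⊤ g) := by
        rw [warpElt, SemidirectProduct.mk_eq_inl_mul_inr, mul_inv_cancel_right, ← map_mul,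
          mul_assoc, ← Pi.mulSingle_mul, inv_inv, inv_mul_cancel, Pi.mulSingle_one, mul_one]
      rw [e]
      exact H.mul_mem (H.mul_mem hw (H.inv_mem (hperm _))) (htop g)
  rw [eq_top_iff]
  rintro ⟨z, π⟩ -
  rw [SemidirectProduct.mk_eq_inl_mul_inr]
  refine H.mul_mem ?_ (hperm π)
  exact Subgroup.pi_mem_of_mulSingle_mem (H := H.comap SemidirectProduct.inl) z
    fun i => hsingle i (z i)

theorem warpTranspose_one_pos : 0 < warpTranspose G n 1 := by
  have e : (lastElt 1 : Monomial G n) = 1 := by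
    rw [lastElt, Pi.mulSingle_one]; rfl
  exact lt_of_le_of_ne (isProb_warpTranspose.1 _) (Ne.symm (e ▸ lastElt_mem_support (1 : G)))

end Generation

/-! ### The lower bound -/

section Lower

variable {n : ℕ} [NeZero n]

/-- The number of fixed points of a permutation below the last place. -/
def fixedCount (π : Equiv.Perm (Fin n)) : ℕ :=
  ((Finset.univ.erase (⊤ : Fin n)).filter fun j => π j = j).card

theorem wordPerm_apply_of_notMem {l : List (Fin n)} {j : Fin n} (hj : j ≠ ⊤) (hl : j ∉ l) :
    wordPerm l j = j := by
  induction l with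
  | nil => rfl
  | cons i l ih =>
    rw [List.mem_cons, not_or] at hl
    rw [wordPerm, Equiv.Perm.mul_apply, ih hl.2, Equiv.swap_apply_of_ne_of_ne hl.1 hj]

theorem missing_le_fixedCount (l : List (Fin n)) : missing ⊤ l ≤ fixedCount (wordPerm l) := by
  refine Finset.card_le_card fun j hj => ?_
  rw [Finset.mem_filter] at hj ⊢
  exact ⟨hj.1, wordPerm_apply_of_notMem (Finset.ne_of_mem_erase hj.1) hj.2⟩

/-- Left multiplication by `(i j)` matches the permutations fixing `j` with those sending `j` to
`i`; over all `i` each permutation is counted once. -/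
theorem card_mul_sum_fixed {α : Type*} [Fintype α] [DecidableEq α] (j : α) :
    (Fintype.card α : ℝ) * ∑ π : Equiv.Perm α, (if π j = j then (1 : ℝ) else 0) =
      (Fintype.card α).factorial := by
  have h : ∀ i : α, ∑ π : Equiv.Perm α, (if π j = j then (1 : ℝ) else 0) =
      ∑ π : Equiv.Perm α, if π j = i then (1 : ℝ) else 0 := by
    intro i
    rw [← Equiv.sum_comp (Equiv.mulLeft (Equiv.swap i j))
      (fun π : Equiv.Perm α => if π j = i then (1 : ℝ) else 0)]
    refine Finset.sum_congr rfl fun π _ => ?_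
    have : (Equiv.mulLeft (Equiv.swap i j)) π j = i ↔ π j = j := by
      rw [Equiv.coe_mulLeft, Equiv.Perm.mul_apply, ← Equiv.eq_symm_apply, Equiv.symm_swap,
        Equiv.swap_apply_left]
    simp only [this]
  calc _ = ∑ i : α, ∑ π : Equiv.Perm α, if π j = i then (1 : ℝ) else 0 := by
        rw [← Finset.sum_congr rfl fun i _ => h i, Finset.sum_const, Finset.card_univ,
          nsmul_eq_mul]
    _ = _ := by
        rw [Finset.sum_comm]
        simp [Fintype.card_perm]

theorem sum_fixedCount_le :
    ∑ π : Equiv.Perm (Fin n), (fixedCount π : ℝ) ≤ n.factorial := by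
  have hn : (0 : ℝ) < n := Nat.cast_pos.2 (NeZero.pos n)
  have h : ∀ j : Fin n, ∑ π : Equiv.Perm (Fin n), (if π j = j then (1 : ℝ) else 0) =
      n.factorial / n := by
    intro j
    rw [eq_div_iff hn.ne', mul_comm]
    simpa using card_mul_sum_fixed j
  have hf : ∀ π : Equiv.Perm (Fin n), (fixedCount π : ℝ) =
      ∑ j ∈ Finset.univ.erase (⊤ : Fin n), if π j = j then (1 : ℝ) else 0 := by
    intro π
    rw [fixedCount, Finset.sum_boole]
  simp only [hf]
  rw [Finset.sum_comm]
  simp only [h]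
  rw [Finset.sum_const, nsmul_eq_mul]
  calc _ ≤ (n : ℝ) * (n.factorial / n) := by
        gcongr
        exact (Finset.card_le_univ _).trans (by simp)
    _ = _ := by field_simp

variable {G : Type*} [Group G] [Fintype G]

theorem sum_filter_convPow (k : ℕ) (p : Equiv.Perm (Fin n) → Prop) [DecidablePred p] :
    ∑ x ∈ Finset.univ.filter (fun x : Monomial G n => p x.right),
        convPow (warpTranspose G n) k x =
      avg k fun l => if p (wordPerm l) then (1 : ℝ) else 0 := by
  rw [Finset.sum_filter, sum_eq_sum_sum]
  have h : ∀ l : List (Fin n), (if p (wordPerm l) then (1 : ℝ) else 0) =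
      ∑ π, ∑ z : Fin n → G, (if p π then 1 else 0) * placeLaw l (⟨z, π⟩ : Monomial G n) := by
    intro l
    simp only [← Finset.mul_sum, sum_placeLaw]
    simp
  simp only [h, avg_sum, avg_const_mul, convPow_eq_avg]
  refine Finset.sum_congr rfl fun π _ => Finset.sum_congr rfl fun z _ => ?_
  split_ifs <;> simp

/-- The distinguishing event is having at least `m/2` fixed points below the last place, where `m`
is the mean number of unpicked places. Chebyshev loses `4/m` for the walk, and Markov gives at most
`2/m` for the uniform law. -/
theorem one_sub_le_tvDist (k : ℕ) (hn : 2 ≤ n) {m : ℝ}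
    (hm : m = ((n : ℝ) - 1) * (1 - 1 / n) ^ k) (hm0 : 0 < m) :
    1 - 6 / m ≤ tvDist (convPow (warpTranspose G n) k) (unif (Monomial G n)) := by
  classical
  refine le_trans ?_ (sub_le_tvDist _ _
    (Finset.univ.filter fun x : Monomial G n => m / 2 ≤ fixedCount x.right))
  have h1 : 1 - 4 / m ≤ ∑ x ∈ Finset.univ.filter
      (fun x : Monomial G n => m / 2 ≤ fixedCount x.right),
        convPow (warpTranspose G n) k x := by
    rw [sum_filter_convPow k fun π => m / 2 ≤ fixedCount π]
    refine (le_avg_half_le_missing (⊤ : Fin n) k (by simpa using hn) (by simpa using hm)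
      hm0).trans (avg_mono k fun l => ?_)
    have := missing_le_fixedCount l
    have : (missing ⊤ l : ℝ) ≤ fixedCount (wordPerm l) := by exact_mod_cast this
    split_ifs with h h'
    · exact le_rfl
    · linarith
    · exact zero_le_one
    · exact le_rfl
  have h2 : ∑ x ∈ Finset.univ.filter
      (fun x : Monomial G n => m / 2 ≤ fixedCount x.right), unif (Monomial G n) x ≤ 2 / m := by
    have hc : (0 : ℝ) < (Fintype.card G : ℝ) ^ n := by positivity
    rw [Finset.sum_filter, sum_eq_sum_sum]
    calc _ ≤ ∑ π : Equiv.Perm (Fin n), ∑ _z : Fin n → G,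
          2 / m * fixedCount π * (1 / ((Fintype.card G : ℝ) ^ n * n.factorial)) := by
          refine Finset.sum_le_sum fun π _ => Finset.sum_le_sum fun z _ => ?_
          rw [unif, card_monomial]
          split_ifs with h
          · refine le_mul_of_one_le_left (by positivity) ?_
            have h' : 2 / m * (m / 2) ≤ 2 / m * fixedCount π := by gcongr
            have : 2 / m * (m / 2) = 1 := by field_simp
            linarith
          · positivity
      _ = 2 / m * ((∑ π : Equiv.Perm (Fin n), (fixedCount π : ℝ)) / n.factorial) := by
          simp only [Finset.sum_const, Finset.card_univ, Fintype.card_fun, Fintype.card_fin,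
            nsmul_eq_mul]
          push_cast
          rw [Finset.sum_div, Finset.mul_sum]
          refine Finset.sum_congr rfl fun π _ => ?_
          field_simp
      _ ≤ 2 / m * 1 := by
          gcongr
          exact div_le_one_of_le₀ sum_fixedCount_le (by positivity)
      _ = 2 / m := mul_one _
  have h3 : 6 / m = 4 / m + 2 / m := by ring
  linarith

end Lower

end Monomial

namespace Monomial

open RandomWalk WordAverage StarSum

/-! ### Cutoff -/

theorem tendsto_pnat_cast : Tendsto (fun n : ℕ+ => (n : ℝ)) atTop atTop :=
  tendsto_natCast_atTop_atTop.comp tendsto_PNat_val_atTop_atTop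

/-- Rounding down loses less than one step, which costs a factor of at most `exp (1/x) ≤ e`. -/
theorem exp_neg_floor_div_le {x ε : ℝ} (hx : 1 ≤ x) :
    Real.exp (-(⌊(1 + ε) * (x * Real.log x)⌋₊ / x)) ≤ Real.exp 1 * x ^ (-(1 + ε)) := by
  have hx0 : 0 < x := by linarith
  have hk := (Nat.lt_floor_add_one ((1 + ε) * (x * Real.log x))).le
  rw [Real.rpow_def_of_pos hx0, ← Real.exp_add, Real.exp_le_exp, neg_le, le_div_iff₀ hx0]
  linarith

/-- With `E = e x^(-(1+ε))`, everything reduces to `x E = e x^(-ε)` and `x E log x` tending to `0`.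
-/
theorem tendsto_upper_bound {ε : ℝ} (hε : 0 < ε) :
    Tendsto (fun x : ℝ => √((1 + ((Real.exp 1 * x ^ (-(1 + ε))) ^ 2) ^ 2) *
        Real.exp (x ^ 2 * (Real.exp 1 * x ^ (-(1 + ε))) ^ 2) - 1) +
        (x + 2 * ((1 + ε) * (x * Real.log x))) * (Real.exp 1 * x ^ (-(1 + ε)))) atTop (𝓝 0) := by
  have hE : Tendsto (fun x : ℝ => Real.exp 1 * x ^ (-(1 + ε))) atTop (𝓝 0) := by
    simpa using (tendsto_rpow_neg_atTop (y := 1 + ε) (by linarith)).const_mul (Real.exp 1)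
  have hxE : Tendsto (fun x : ℝ => x * (Real.exp 1 * x ^ (-(1 + ε)))) atTop (𝓝 0) := by
    have h : Tendsto (fun x : ℝ => Real.exp 1 * x ^ (-ε)) atTop (𝓝 0) := by
      simpa using (tendsto_rpow_neg_atTop hε).const_mul (Real.exp 1)
    refine h.congr' ?_
    filter_upwards [eventually_gt_atTop 0] with x hx
    rw [mul_left_comm, ← Real.rpow_one_add' hx.le (by linarith)]
    congr 2
    ring
  have hlog : Tendsto (fun x : ℝ => Real.log x * (x * (Real.exp 1 * x ^ (-(1 + ε)))))
      atTop (𝓝 0) := by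
    have h := ((isLittleO_log_rpow_atTop hε).tendsto_div_nhds_zero).const_mul (Real.exp 1)
    rw [mul_zero] at h
    refine h.congr' ?_
    filter_upwards [eventually_gt_atTop 0] with x hx
    rw [mul_left_comm x, ← Real.rpow_one_add' hx.le (by linarith), div_eq_mul_inv,
      ← Real.rpow_neg hx.le]
    rw [show 1 + -(1 + ε) = -ε by ring]
    ring
  have h1 : Tendsto (fun x : ℝ => √((1 + ((Real.exp 1 * x ^ (-(1 + ε))) ^ 2) ^ 2) *
      Real.exp ((x * (Real.exp 1 * x ^ (-(1 + ε)))) ^ 2) - 1)) atTop (𝓝 0) := by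
    have := ((((((hE.pow 2).pow 2).const_add 1).mul
      ((Real.continuous_exp.tendsto _).comp (hxE.pow 2))).sub_const 1)).sqrt
    simpa using this
  have h2 := (hxE.add (hlog.const_mul (2 * (1 + ε))))
  have h3 := h1.add h2
  simp only [mul_zero, add_zero] at h3
  refine h3.congr fun x => ?_
  rw [mul_pow x]
  ring

theorem upper_cutoff (G : ℕ+ → Type*) [∀ n, Group (G n)] [∀ n, Fintype (G n)] {ε : ℝ}
    (hε : 0 < ε) :
    Tendsto (fun n : ℕ+ => tvDist (convPow (warpTranspose (G n) (n : ℕ))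
      ⌊(1 + ε) * ((n : ℝ) * Real.log (n : ℝ))⌋₊) (unif (Monomial (G n) (n : ℕ))))
      atTop (𝓝 0) := by
  refine squeeze_zero' (Eventually.of_forall fun n => tvDist_nonneg _ _) ?_
    ((tendsto_upper_bound hε).comp tendsto_pnat_cast)
  filter_upwards [tendsto_pnat_cast.eventually_ge_atTop 2] with n hn
  have hn2 : 2 ≤ (n : ℕ) := by exact_mod_cast hn
  have hlog : 1 / 2 ≤ Real.log (n : ℝ) := by
    have := Real.log_two_gt_d9
    have := Real.log_le_log (by norm_num) hn
    linarith
  have hT : 1 ≤ (n : ℝ) * Real.log n := by nlinarith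
  have hT' : 1 ≤ (1 + ε) * ((n : ℝ) * Real.log n) := by nlinarith
  have hk : 0 < ⌊(1 + ε) * ((n : ℝ) * Real.log n)⌋₊ := Nat.floor_pos.2 hT'
  refine (tvDist_le_sqrt hk hn2).trans ?_
  have hE := exp_neg_floor_div_le (x := n) (ε := ε) (by linarith)
  have hfl := Nat.floor_le (show 0 ≤ (1 + ε) * ((n : ℝ) * Real.log n) by linarith)
  set k := ⌊(1 + ε) * ((n : ℝ) * Real.log n)⌋₊
  have hE2 : Real.exp (-(2 * k / (n : ℝ))) ≤ (Real.exp 1 * (n : ℝ) ^ (-(1 + ε))) ^ 2 := by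
    have : Real.exp (-(2 * k / (n : ℝ))) = Real.exp (-(k / (n : ℝ))) ^ 2 := by
      rw [← Real.exp_nat_mul]; congr 1; push_cast; ring
    rw [this]
    gcongr
  simp only [Function.comp]
  gcongr

theorem lower_cutoff (G : ℕ+ → Type*) [∀ n, Group (G n)] [∀ n, Fintype (G n)] {ε : ℝ}
    (hε : 0 < ε) (hε1 : ε < 1) :
    Tendsto (fun n : ℕ+ => tvDist (convPow (warpTranspose (G n) (n : ℕ))
      ⌊(1 - ε) * ((n : ℝ) * Real.log (n : ℝ))⌋₊) (unif (Monomial (G n) (n : ℕ))))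
      atTop (𝓝 1) := by
  have hlim : Tendsto (fun n : ℕ+ => 1 - 12 * Real.exp 1 * (n : ℝ) ^ (-ε)) atTop (𝓝 1) := by
    simpa using (((tendsto_rpow_neg_atTop hε).comp tendsto_pnat_cast).const_mul
      (12 * Real.exp 1)).const_sub 1
  refine tendsto_of_tendsto_of_tendsto_of_le_of_le' hlim tendsto_const_nhds ?_
    (Eventually.of_forall fun n => tvDist_le_one (isProb_convPow isProb_warpTranspose _)
      (isProb_unif _))
  filter_upwards [tendsto_pnat_cast.eventually_ge_atTop 2] with n hn
  have hn2 : 2 ≤ (n : ℕ) := by exact_mod_cast hn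
  have hn0 : (0 : ℝ) < n := by linarith
  have hlog0 : 0 ≤ Real.log (n : ℝ) := Real.log_nonneg (by linarith)
  have hlog1 : Real.log (n : ℝ) ≤ n - 1 := Real.log_le_sub_one_of_pos hn0
  have hfl := Nat.floor_le (show 0 ≤ (1 - ε) * ((n : ℝ) * Real.log n) by
    have : 0 ≤ 1 - ε := by linarith
    positivity)
  set k := ⌊(1 - ε) * ((n : ℝ) * Real.log n)⌋₊
  -- This is `1 + u ≤ exp u` at `u = 1/(n - 1)`, since `1 - 1/n = 1/(1 + u)`.
  have hbase : Real.exp (-(1 / ((n : ℝ) - 1))) ≤ 1 - 1 / n := by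
    rw [Real.exp_neg]
    have h1 := Real.add_one_le_exp (1 / ((n : ℝ) - 1))
    have h2 : 1 - 1 / (n : ℝ) = (1 / ((n : ℝ) - 1) + 1)⁻¹ := by
      have : (n : ℝ) - 1 ≠ 0 := by linarith
      field_simp
      ring
    rw [h2]
    have : 0 < 1 / ((n : ℝ) - 1) + 1 := by
      have : 0 < (n : ℝ) - 1 := by linarith
      positivity
    gcongr
  have hpow : Real.exp (-1) * (n : ℝ) ^ (ε - 1) ≤ (1 - 1 / (n : ℝ)) ^ k := by
    refine le_trans ?_ (pow_le_pow_left₀ (Real.exp_pos _).le hbase k)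
    rw [← Real.exp_nat_mul, Real.rpow_def_of_pos hn0, ← Real.exp_add, Real.exp_le_exp]
    have hn1 : 0 < (n : ℝ) - 1 := by linarith
    -- Split `n log n = (n - 1) log n + log n` and use `log n ≤ n - 1`; the second summand is the
    -- source of the factor `exp (-1)`.
    have h3 : (k : ℝ) ≤ (1 + (1 - ε) * Real.log n) * ((n : ℝ) - 1) := by nlinarith
    have h4 : (k : ℝ) * (1 / ((n : ℝ) - 1)) ≤ 1 + (1 - ε) * Real.log n := by
      rw [mul_one_div, div_le_iff₀ hn1]; exact h3
    linarith
  have hm : (n : ℝ) ^ ε / (2 * Real.exp 1) ≤ ((n : ℝ) - 1) * (1 - 1 / (n : ℝ)) ^ k := by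
    calc (n : ℝ) ^ ε / (2 * Real.exp 1) = (n : ℝ) / 2 * (Real.exp (-1) * (n : ℝ) ^ (ε - 1)) := by
          rw [Real.rpow_sub_one hn0.ne', Real.exp_neg]
          field_simp
      _ ≤ ((n : ℝ) - 1) * (1 - 1 / (n : ℝ)) ^ k := by
          refine mul_le_mul (by linarith) hpow (by positivity) (by linarith)
  have hpos : 0 < (n : ℝ) ^ ε / (2 * Real.exp 1) := by positivity
  refine le_trans ?_ (one_sub_le_tvDist k hn2 rfl (hpos.trans_le hm))
  have h5 : 6 / (((n : ℝ) - 1) * (1 - 1 / (n : ℝ)) ^ k) ≤ 6 / ((n : ℝ) ^ ε / (2 * Real.exp 1)) := by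
    gcongr
  have h6 : 6 / ((n : ℝ) ^ ε / (2 * Real.exp 1)) = 12 * Real.exp 1 * (n : ℝ) ^ (-ε) := by
    rw [Real.rpow_neg hn0.le]
    field_simp
    norm_num
  linarith

end Monomial

theorem mainTheorem1 (G : ℕ+ → Type*) [∀ n, Group (G n)] [∀ n, Fintype (G n)]
    [∀ n, Nontrivial (G n)] :
    RandomWalk.HasTVCutoff (fun n : ℕ+ => Monomial (G n) (n : ℕ))
      (fun n : ℕ+ => Monomial.warpTranspose (G n) (n : ℕ))
      (fun n : ℕ+ => (n : ℝ) * Real.log (n : ℝ)) where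
  isProb _ := Monomial.isProb_warpTranspose
  generates _ := Monomial.closure_support_warpTranspose
  irreducible _ := RandomWalk.isIrred_transition Monomial.isProb_warpTranspose.1
    Monomial.closure_support_warpTranspose
  aperiodic _ := RandomWalk.isAperiodic_transition Monomial.warpTranspose_one_pos
  tendsto_time := Monomial.tendsto_pnat_cast.atTop_mul_atTop₀
    (Real.tendsto_log_atTop.comp Monomial.tendsto_pnat_cast)
  upper _ hε _ := Monomial.upper_cutoff G hε
  lower _ hε hε1 := Monomial.lower_cutoff G hε hε1
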